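/- Let $T>0$ and let $U_0:\mathbb R\to\mathbb R$ be a $C^\infty$, $T$-periodic finite-gap potential. Here $U_0$ is called finite-gap if it has a spectral curve $\Gamma: y^2=R(E)$, where $R$ is a monic square-free polynomial of odd degree. This means that there are entire functions $S$ and $f\not\equiv0$ such that, for every $E\in\mathbb C$, the Bloch multipliers $\varkappa$ of $-\psi''+U_0\psi=E\psi$, $\psi(x+T)=\varkappa\psi(x)$, $\psi\not\equiv 0$, are exactly the numbers $S(E)+f(E)y$ with $y^2=R(E)$; in other words, $\Gamma$ is the nonsingular Riemann surface of the Bloch function. For a $T$-periodic potential $U$ that is smooth on $\mathbb R\setminus T\mathbb Z$ the Bloch curve, i.e. the set of all such pairs $(E,\varkappa)$, and the spectral curve are defined in the same way, with solutions $\psi$ on $\mathbb R\setminus T\mathbb Z$ that have at most a pole at each point of $T\mathbb Z$ (that is, near each $x_0\in T\mathbb Z$ one has $\psi(x)=g(x)/(x-x_0)^n$ with one function $g$ that is $C^\infty$ near $x_0$). The Dirichlet--Hermit spectrum of $U$ is the set of real $E$ such that $-f''+Uf=Ef$ has a nonzero real solution on $(0,T)$ with $f(x)\to0$ as $x\to0^+$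 and as $x\to T^-$. The Crum transform of $U$ is $U-2(\log\eta)''$, where $\eta$ is the ground state: a real solution, not identically zero on $(0,T)$, for the lowest $E$ of the Dirichlet--Hermit spectrum, which is $C^\infty$ on $\mathbb R$ and vanishes on $T\mathbb Z$. Then, for every integer $r\ge 0$, the potential $U_r$ obtained from $U_0$ by $r$ successive Crum transformations exists and is unique, and: 1. $U_r$ is $T$-periodic, it is $C^\infty$ on $\mathbb R\setminus T\mathbb Z$, and near $x=0$ it has the form $U_r(x)=\frac{r(r+1)}{x^2}+h(x)$ with $h$ of class $C^\infty$ near $0$; in particular $U_r(x)=\frac{r(r+1)}{x^2}+c+O(x)$ with a constant $c$. So for $r\ge1$ it has exactly one pole per period, at $x=0$. 2. $U_r$ has the same Bloch curve and the same spectral curve $\Gamma$ as $U_0$. 3. The Dirichlet--Hermit spectrum of $U_0$ is a strictly increasing sequence $\mu_0<\mu_1<\mu_2<\cdots$, and that of $U_r$ is $\mu_r<\mu_{r+1}<\cdots$, i.e. the $r$ lowest states are removed. -/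

import Mathlib

open Set Filter Topology
open scoped ContDiff Polynomial

/-- The points `k T`, `k ∈ ℤ`, where the transformed potentials may have poles. -/
def poleLattice (T : ℝ) : Set ℝ :=
  Set.range fun k : ℤ => (k : ℝ) * T

/-- `ψ` is a (twice continuously differentiable) solution of `-ψ'' + U ψ = E ψ` on the open
set `s`. Real-valued solutions (`𝕜 = ℝ`) and complex-valued ones (`𝕜 = ℂ`) are both needed. -/
def SolvesSchrodingerOn {𝕜 : Type} [RCLike 𝕜] (s : Set ℝ) (U : ℝ → ℝ) (E : 𝕜)
    (ψ : ℝ → 𝕜) : Prop :=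
  ContDiffOn ℝ 2 ψ s ∧ ∀ x ∈ s, -deriv (deriv ψ) x + U x • ψ x = E * ψ x

/-- The Dirichlet (Hermit) spectrum: the eigenvalues of `-∂² + U` on the interval `(0, T)` with
zero boundary conditions at both ends. The potential may be singular at the ends, so the
boundary conditions are expressed by one-sided limits. -/
def hermitSpectrum (T : ℝ) (U : ℝ → ℝ) : Set ℝ :=
  {E | ∃ f : ℝ → ℝ, SolvesSchrodingerOn (Ioo 0 T) U E f ∧
    Tendsto f (𝓝[>] 0) (𝓝 0) ∧ Tendsto f (𝓝[<] T) (𝓝 0) ∧ ∃ x ∈ Ioo 0 T, f x ≠ 0}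

/-- `η` is a ground state of the Dirichlet (Hermit) problem, continued to the whole line as a
nonsingular solution of the same equation: its energy is the lowest point of the spectrum. -/
def IsGroundState (T : ℝ) (U η : ℝ → ℝ) : Prop :=
  ContDiff ℝ ∞ η ∧ (∀ x ∈ poleLattice T, η x = 0) ∧ (∃ x ∈ Ioo 0 T, η x ≠ 0) ∧
    ∃ E : ℝ, IsLeast (hermitSpectrum T U) E ∧ SolvesSchrodingerOn (poleLattice T)ᶜ U E η

/-- The Darboux transform `U - 2 (log η)''`. Here `logDeriv η = η' / η`; the values at the zeros
of `η` carry no meaning. -/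
noncomputable def darbouxTransform (U η : ℝ → ℝ) : ℝ → ℝ :=
  fun x => U x - 2 * deriv (logDeriv η) x

/-- `V` is the Crum transform of `U`: the Darboux transform of `U` over a ground state. -/
def IsCrumTransform (T : ℝ) (U V : ℝ → ℝ) : Prop :=
  ∃ η : ℝ → ℝ, IsGroundState T U η ∧ V = darbouxTransform U η

/-- `IsCrumIterate T U₀ r V`: the potential `V` is obtained from `U₀` by `r` successive Crum
transformations, each over the ground state of the potential reached so far. -/
inductive IsCrumIterate (T : ℝ) (U₀ : ℝ → ℝ) : ℕ → (ℝ → ℝ) → Prop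
  | zero : IsCrumIterate T U₀ 0 U₀
  | succ {r : ℕ} {U V : ℝ → ℝ} :
      IsCrumIterate T U₀ r U → IsCrumTransform T U V → IsCrumIterate T U₀ (r + 1) V

/-- `ψ` has at most a pole at `x₀`: near `x₀`, and away from it, `ψ x = g x / (x - x₀) ^ n` with
`g` smooth at `x₀`, the same `g` on both sides. -/
def HasAtMostPoleAt (ψ : ℝ → ℂ) (x₀ : ℝ) : Prop :=
  ∃ (n : ℕ) (g : ℝ → ℂ), ContDiffAt ℝ ∞ g x₀ ∧
    ∀ᶠ x in 𝓝[≠] x₀, ψ x = g x / ((x : ℂ) - (x₀ : ℂ)) ^ n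

/-- The Bloch-Floquet curve of `-∂² + U`: the pairs `(E, ϰ)` such that `-ψ'' + U ψ = E ψ` has a
nonzero Bloch solution, `ψ (x + T) = ϰ ψ x`, on the real line. Where `U` has a pole the two
sides are connected by the requirement that `ψ` has at most a pole. -/
def blochCurve (T : ℝ) (U : ℝ → ℝ) : Set (ℂ × ℂ) :=
  {p | ∃ ψ : ℝ → ℂ, SolvesSchrodingerOn (poleLattice T)ᶜ U p.1 ψ ∧
    (∀ x₀ ∈ poleLattice T, HasAtMostPoleAt ψ x₀) ∧
    (∀ x ∉ poleLattice T, ψ (x + T) = p.2 * ψ x) ∧ ∃ x ∉ poleLattice T, ψ x ≠ 0}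

/-- The nonsingular hyperelliptic curve `Γ : y² = R(E)`, of genus `(deg R - 1) / 2` and with one
point at infinity, is the spectral curve of `-∂² + U`: the Bloch multiplier is a single-valued
holomorphic function `ϰ = S(E) + f(E) y` on the finite part of `Γ`, and `(E, y) ↦ (E, ϰ)` maps it
onto the Bloch-Floquet curve, generically one-to-one since `f` is not identically zero. (So `Γ`
is the Riemann surface of the Bloch function.) A potential is finite-gap if it has such an `R`. -/
def IsSpectralCurve (T : ℝ) (U : ℝ → ℝ) (R : ℂ[X]) : Prop :=
  R.Monic ∧ Squarefree R ∧ Odd R.natDegree ∧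
    ∃ S f : ℂ → ℂ, Differentiable ℂ S ∧ Differentiable ℂ f ∧ f ≠ 0 ∧
      ∀ E ϰ : ℂ, (E, ϰ) ∈ blochCurve T U ↔ ∃ y : ℂ, y ^ 2 = R.eval E ∧ ϰ = S E + f E * y

/-!
The Darboux transformation over a solution `η` of `-η'' + U η = E₀ η` is the factorization
`-∂² + U - E₀ = -(∂ + v) (∂ - v)`, `v = η'/η`: the transform `V = U - 2 v'` has the two factors in
the opposite order, so `∂ - v` takes solutions for `U` to solutions for `V` and `∂ + v` takes them
back (`IsDarbouxPair`). Everything follows by induction along the chain from properties that one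
Crum transformation preserves (`IsCrumState`, `IsCrumState.exists_unique_transform`).

* *The ground state.* For the smooth potential, Sturm's oscillation theorem, proved with the
  Prüfer angle, gives the Dirichlet eigenvalues `μ 0 < μ 1 < ⋯` and at most `n` zeros in `(0, T)`
  for the `n`-th eigenfunction (`exists_dirichlet_eigenvalues`). A transformed eigenfunction is
  `W / η` with the Wronskian `W` of the eigenfunction `f` and `η`. Since `W' = (E₀ - E) f η`,
  Rolle's theorem shows that one zero is lost at each step, while the order of vanishing at the
  lattice goes up by one (`IsBlochEigenfunction.transform`). After `m` steps the lowest remaining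
  eigenfunction therefore has no zeros in `(0, T)`, is smooth on the line and vanishes on the
  lattice exactly to the order `m + 1`. This makes it the next ground state and turns the pole
  `m (m + 1) / x²` into `(m + 1) (m + 2) / x²`. It is unique up to a factor, because a smooth
  function cannot change its factor at a zero of finite order (`eq_of_eventually_eq_smul`).

* *The spectrum.* Conversely, `∂ + v` takes a Dirichlet eigenfunction `f` of `V` to one of `U`:
  the equation near the pole forces `f' → 0` and `f / x → 0` (`tendsto_deriv_of_tendsto_zero`).
  The energy `E₀` is lost, since it would make `(∂ + v) f` a multiple `c η`, so that `η f` is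
  monotone with derivative `c η²` and vanishes at both ends.

* *The Bloch curve.* `∂ - v` and `∂ + v` preserve the multiplier, as `v` is periodic, and they are
  injective except at `E₀`, where their kernels are spanned by `η` and `1 / η`, with the
  multipliers `ρ` and `ρ⁻¹`. So both curves have to contain `(E₀, ρ)` and `(E₀, ρ⁻¹)`. For `V` the
  solutions `w / η` with `w' = c η²` do this. For `U` the point `(E₀, ρ⁻¹)` comes from the smooth
  potential, whose monodromy has determinant `1`; it is carried along the chain with the Bloch
  curve itself. The spectral curve is determined by the Bloch curve.
-/

/-! ### Smooth functions at a zero of finite order -/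

lemma hasDerivAt_integral_pow_mul_comp (m : ℕ) {G : ℝ → ℝ} (hG : ContDiff ℝ 1 G) (x₀ : ℝ) :
    HasDerivAt (fun x => ∫ s in (0 : ℝ)..1, s ^ m * G (s * x))
      (∫ s in (0 : ℝ)..1, s ^ (m + 1) * deriv G (s * x₀)) x₀ := by
  have hG' : Continuous (deriv G) := hG.continuous_deriv le_rfl
  have hGc : Continuous G := hG.continuous
  obtain ⟨C, hC⟩ := (isCompact_Icc (a := -(|x₀| + 1)) (b := |x₀| + 1)).exists_bound_of_continuousOn
    hG'.continuousOn
  refine (intervalIntegral.hasDerivAt_integral_of_dominated_loc_of_deriv_le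
    (F := fun x s => s ^ m * G (s * x)) (F' := fun x s => s ^ (m + 1) * deriv G (s * x))
    (bound := fun _ => C) (s := Metric.ball x₀ 1)
    (Metric.ball_mem_nhds x₀ one_pos) ?_ ?_ ?_ ?_ ?_ ?_).2
  · exact Eventually.of_forall fun x =>
      (by fun_prop : Continuous fun s : ℝ => s ^ m * G (s * x)).aestronglyMeasurable
  · exact (by fun_prop : Continuous fun s : ℝ => s ^ m * G (s * x₀)).intervalIntegrable _ _
  · exact (by fun_prop :
      Continuous fun s : ℝ => s ^ (m + 1) * deriv G (s * x₀)).aestronglyMeasurable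
  · refine Eventually.of_forall fun s hs x hx => ?_
    rw [uIoc_of_le zero_le_one] at hs
    rw [Metric.mem_ball, Real.dist_eq] at hx
    have hx' : |x| ≤ |x₀| + 1 := by
      have := abs_sub_abs_le_abs_sub x x₀
      linarith
    have hsx : |s * x| ≤ |x₀| + 1 := by
      rw [abs_mul, abs_of_pos hs.1]
      nlinarith [hs.1, hs.2, abs_nonneg x]
    have hb := hC (s * x) (abs_le.mp hsx)
    have hs1 : |s ^ (m + 1)| ≤ 1 := by
      rw [abs_of_nonneg (pow_nonneg hs.1.le _)]
      exact pow_le_one₀ hs.1.le hs.2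
    rw [norm_mul, Real.norm_eq_abs (s ^ (m + 1))]
    nlinarith [norm_nonneg (deriv G (s * x)), abs_nonneg (s ^ (m + 1))]
  · exact intervalIntegrable_const
  · refine Eventually.of_forall fun s _ x _ => ?_
    have h1 : HasDerivAt (fun x => G (s * x)) (deriv G (s * x) * s) x :=
      ((hG.differentiable one_ne_zero) (s * x)).hasDerivAt.comp x
        (by simpa using (hasDerivAt_id x).const_mul s)
    exact (h1.const_mul (s ^ m)).congr_deriv (by ring)

lemma contDiff_integral_pow_mul_comp (m : ℕ) {G : ℝ → ℝ} (hG : ContDiff ℝ ∞ G) :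
    ContDiff ℝ ∞ (fun x => ∫ s in (0 : ℝ)..1, s ^ m * G (s * x)) := by
  rw [contDiff_infty]
  intro n
  induction n generalizing m G with
  | zero =>
    rw [Nat.cast_zero, contDiff_zero]
    exact continuous_iff_continuousAt.mpr fun x =>
      (hasDerivAt_integral_pow_mul_comp m (hG.of_le (by simp)) x).continuousAt
  | succ n ih =>
    have hd := fun x => hasDerivAt_integral_pow_mul_comp m (hG.of_le (by simp)) x
    rw [Nat.cast_add, Nat.cast_one, contDiff_succ_iff_deriv]
    refine ⟨fun x => (hd x).differentiableAt, by simp, ?_⟩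
    rw [show deriv _ = _ from funext fun x => (hd x).deriv]
    exact ih (m + 1) (contDiff_infty_iff_deriv.mp hG).2

/-- Division with remainder zero for smooth functions: if `W` vanishes at `0` and `W'` is `x ^ m`
times a smooth function `G`, then `W` is `x ^ (m + 1)` times a smooth function, namely
`∫₀¹ s ^ m G (s x) ds`. -/
lemma exists_contDiff_eq_pow_mul {m : ℕ} {W G : ℝ → ℝ} (hG : ContDiff ℝ ∞ G)
    (hW : ∀ x, HasDerivAt W (x ^ m * G x) x) (hW0 : W 0 = 0) :
    ∃ K : ℝ → ℝ, ContDiff ℝ ∞ K ∧ K 0 = G 0 / (m + 1) ∧ ∀ x, W x = x ^ (m + 1) * K x := by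
  refine ⟨_, contDiff_integral_pow_mul_comp m hG, ?_, fun x => ?_⟩
  · simp only [mul_zero, intervalIntegral.integral_mul_const, integral_pow]
    simp
    ring
  · have hc : Continuous fun x : ℝ => x ^ m * G x := by
      have := hG.continuous
      fun_prop
    have h1 : ∫ t in (0 : ℝ)..x, t ^ m * G t = W x - W 0 :=
      intervalIntegral.integral_eq_sub_of_hasDerivAt (fun t _ => hW t) (hc.intervalIntegrable _ _)
    have h2 := intervalIntegral.smul_integral_comp_mul_left (a := 0) (b := 1)
      (fun t : ℝ => t ^ m * G t) x
    rw [mul_zero, mul_one, h1, hW0, sub_zero] at h2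
    rw [← h2, smul_eq_mul, pow_succ', mul_assoc, ← intervalIntegral.integral_const_mul (x ^ m)]
    congr 2
    ext s
    rw [mul_pow, mul_comm x s]
    ring

/-- A function of class `C ^ N` that vanishes to the left of `a` is `o ((x - a) ^ N)`. -/
lemma isLittleO_pow_of_eventuallyEq_zero_left {E : Type*} [NormedAddCommGroup E] [NormedSpace ℝ E]
    {D : ℝ → E} {a : ℝ} {N : ℕ} (hD : ContDiffAt ℝ N D a) (h0 : ∀ᶠ x in 𝓝[<] a, D x = 0) :
    D =o[𝓝[>] a] fun x => (x - a) ^ N := by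
  induction N generalizing D with
  | zero =>
    have hc : Tendsto D (𝓝 a) (𝓝 (D a)) := hD.continuousAt
    have h1 : Tendsto D (𝓝[<] a) (𝓝 0) :=
      tendsto_const_nhds.congr' (h0.mono fun x hx => hx.symm)
    have h2 : D a = 0 := tendsto_nhds_unique (hc.mono_left nhdsWithin_le_nhds) h1
    simp only [pow_zero]
    rw [Asymptotics.isLittleO_one_iff]
    rw [h2] at hc
    exact hc.mono_left nhdsWithin_le_nhds
  | succ N ih =>
    have hDa : D a = 0 := by
      have hc : Tendsto D (𝓝 a) (𝓝 (D a)) := hD.continuousAt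
      have h1 : Tendsto D (𝓝[<] a) (𝓝 0) :=
        tendsto_const_nhds.congr' (h0.mono fun x hx => hx.symm)
      exact tendsto_nhds_unique (hc.mono_left nhdsWithin_le_nhds) h1
    have hd : ContDiffAt ℝ N (deriv D) a := hD.derivWithin (by norm_cast)
    have hdiff : ∀ᶠ x in 𝓝 a, DifferentiableAt ℝ D x := by
      have := hD.eventually (by simp)
      exact this.mono fun x hx => hx.differentiableAt (by simp)
    have h0' : ∀ᶠ x in 𝓝[<] a, deriv D x = 0 := by
      have h2 : ∀ᶠ x in 𝓝[<] a, ∀ᶠ y in 𝓝 x, D y = 0 := by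
        have := eventually_eventually_nhdsWithin.mpr h0
        filter_upwards [this, self_mem_nhdsWithin] with x hx hxa
        rwa [isOpen_Iio.nhdsWithin_eq hxa] at hx
      filter_upwards [h2] with x hx
      have : D =ᶠ[𝓝 x] fun _ => 0 := hx
      rw [this.deriv_eq]
      simp
    have key := ih hd h0'
    rw [Asymptotics.isLittleO_iff] at key ⊢
    intro c hc
    have key' := key hc
    rw [eventually_nhdsWithin_iff, Metric.eventually_nhds_iff] at key'
    rw [Metric.eventually_nhds_iff] at hdiff
    obtain ⟨ε, hε, hkey⟩ := key'
    obtain ⟨ε', hε', hdiff⟩ := hdiff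
    rw [eventually_nhdsWithin_iff, Metric.eventually_nhds_iff]
    refine ⟨min ε ε', lt_min hε hε', fun x hx hxa => ?_⟩
    rw [Real.dist_eq] at hx
    have hxa' : a < x := hxa
    rw [abs_of_pos (sub_pos.mpr hxa')] at hx
    have hx1 := hx.trans_le (min_le_left _ _)
    have hx2 := hx.trans_le (min_le_right _ _)
    have hmv := norm_image_sub_le_of_norm_deriv_le_segment' (f := D) (f' := deriv D)
      (a := a) (b := x) (C := c * (x - a) ^ N) (fun t ht => ?_) (fun t ht => ?_) x
      (right_mem_Icc.mpr hxa'.le)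
    · rw [hDa, sub_zero] at hmv
      rw [Real.norm_of_nonneg (pow_nonneg (sub_pos.mpr hxa').le _), pow_succ, ← mul_assoc]
      exact hmv
    · refine (hdiff ?_).hasDerivAt.hasDerivWithinAt
      rw [Real.dist_eq, abs_of_nonneg (by linarith [ht.1])]
      linarith [ht.2]
    · rcases eq_or_lt_of_le ht.1 with h | h
      · subst h
        have hc' : Tendsto (deriv D) (𝓝 a) (𝓝 (deriv D a)) := hd.continuousAt
        have h1 : Tendsto (deriv D) (𝓝[<] a) (𝓝 0) :=
          tendsto_const_nhds.congr' (h0'.mono fun x hx => hx.symm)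
        rw [tendsto_nhds_unique (hc'.mono_left nhdsWithin_le_nhds) h1, norm_zero]
        exact mul_nonneg hc.le (pow_nonneg (sub_pos.mpr hxa').le _)
      · have := hkey (y := t) (by rw [Real.dist_eq, abs_of_pos (by linarith)]; linarith [ht.2]) h
        rw [Real.norm_of_nonneg (pow_nonneg (sub_pos.mpr h).le _)] at this
        refine this.trans ?_
        have := ht.2
        gcongr

/-- A smooth function cannot change its proportionality factor to a function with a zero of
finite order when it passes through that zero. -/
lemma eq_of_eventually_eq_smul {E : Type*} [NormedAddCommGroup E] [NormedSpace ℝ E]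
    {g : ℝ → E} {F K : ℝ → ℝ} {a : ℝ} {N : ℕ} {cl cr : E} (hg : ContDiffAt ℝ ∞ g a)
    (hK : ContDiffAt ℝ ∞ K a) (hKa : K a ≠ 0) (hF : ∀ᶠ x in 𝓝 a, F x = (x - a) ^ N * K x)
    (hl : ∀ᶠ x in 𝓝[<] a, g x = F x • cl) (hr : ∀ᶠ x in 𝓝[>] a, g x = F x • cr) : cl = cr := by
  have hD : ContDiffAt ℝ N (fun x => g x - ((x - a) ^ N * K x) • cl) a := by
    have h1 : ContDiffAt ℝ N g a := hg.of_le (by exact_mod_cast le_top)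
    have h2 : ContDiffAt ℝ N K a := hK.of_le (by exact_mod_cast le_top)
    exact h1.sub (((((contDiffAt_id.sub contDiffAt_const).pow N)).mul h2).smul contDiffAt_const)
  have h0 : ∀ᶠ x in 𝓝[<] a, g x - ((x - a) ^ N * K x) • cl = 0 := by
    filter_upwards [hl, hF.filter_mono nhdsWithin_le_nhds] with x h1 h2
    rw [h1, h2, sub_self]
  have ho := isLittleO_pow_of_eventuallyEq_zero_left hD h0
  have ho' : (fun x => K x • (cr - cl)) =o[𝓝[>] a] fun _ => (1 : ℝ) := by
    rw [Asymptotics.isLittleO_iff] at ho ⊢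
    intro c hc
    filter_upwards [ho hc, hr, hF.filter_mono nhdsWithin_le_nhds, self_mem_nhdsWithin] with
      x h1 h2 h3 hx
    have hpos : 0 < (x - a) ^ N := pow_pos (sub_pos.mpr hx) N
    rw [h2, h3, ← smul_sub, mul_smul, norm_smul, Real.norm_of_nonneg hpos.le, mul_comm] at h1
    simpa using le_of_mul_le_mul_right h1 hpos
  rw [Asymptotics.isLittleO_one_iff] at ho'
  have hlim : Tendsto (fun x => K x • (cr - cl)) (𝓝[>] a) (𝓝 (K a • (cr - cl))) :=
    (hK.continuousAt.tendsto.mono_left nhdsWithin_le_nhds).smul_const _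
  have := tendsto_nhds_unique hlim ho'
  rcases smul_eq_zero.mp this with h | h
  · exact absurd h hKa
  · exact (sub_eq_zero.mp h).symm

/-! ### Counting zeros -/

/-- Rolle's theorem, counted: a function that vanishes at both ends of an interval has fewer
zeros inside than its derivative. -/
lemma finite_zeros_of_finite_zeros_deriv {F : ℝ → ℝ} {a b : ℝ} {N : ℕ} (hab : a < b)
    (hF : ContinuousOn F (Icc a b)) (ha : F a = 0) (hb : F b = 0)
    (hfin : {x ∈ Ioo a b | deriv F x = 0}.Finite)
    (hcard : {x ∈ Ioo a b | deriv F x = 0}.ncard ≤ N + 1) :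
    {x ∈ Ioo a b | F x = 0}.Finite ∧ {x ∈ Ioo a b | F x = 0}.ncard ≤ N := by
  have key : ∀ Z : Finset ℝ, (Z : Set ℝ) ⊆ {x ∈ Ioo a b | F x = 0} → Z.card ≤ N := by
    intro Z hZ
    have haZ : a ∉ insert b Z := by
      simp only [Finset.mem_insert, not_or]
      exact ⟨hab.ne, fun h => lt_irrefl a (hZ h).1.1⟩
    have hbZ : b ∉ Z := fun h => lt_irrefl b (hZ h).1.2
    have hmem : ∀ x ∈ insert a (insert b Z), x ∈ Icc a b ∧ F x = 0 := by
      intro x hx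
      simp only [Finset.mem_insert] at hx
      rcases hx with rfl | rfl | hx
      · exact ⟨left_mem_Icc.mpr hab.le, ha⟩
      · exact ⟨right_mem_Icc.mpr hab.le, hb⟩
      · exact ⟨Ioo_subset_Icc_self (hZ hx).1, (hZ hx).2⟩
    have := Finset.card_le_of_interleaved (s := insert a (insert b Z)) (t := hfin.toFinset) (by
      intro x hx y hy hxy _
      obtain ⟨hx1, hx2⟩ := hmem x hx
      obtain ⟨hy1, hy2⟩ := hmem y hy
      obtain ⟨c, hc, hc0⟩ := exists_deriv_eq_zero hxy
        (hF.mono (Icc_subset_Icc hx1.1 hy1.2)) (hx2.trans hy2.symm)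
      refine ⟨c, ?_, hc.1, hc.2⟩
      rw [Set.Finite.mem_toFinset]
      exact ⟨⟨hx1.1.trans_lt hc.1, hc.2.trans_le hy1.2⟩, hc0⟩)
    rw [Finset.card_insert_of_notMem haZ, Finset.card_insert_of_notMem hbZ,
      ← Set.ncard_eq_toFinset_card _ hfin] at this
    omega
  have hfin' : {x ∈ Ioo a b | F x = 0}.Finite := by
    by_contra hinf
    obtain ⟨Z, hZ, hZc⟩ := Set.Infinite.exists_subset_card_eq hinf (N + 1)
    have := key Z hZ
    omega
  refine ⟨hfin', ?_⟩
  rw [Set.ncard_eq_toFinset_card _ hfin']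
  exact key _ (by simp)

/-! ### Global solutions of scalar and second-order equations -/

open scoped NNReal in
/-- The Picard–Lindelöf theorem for a bounded, globally Lipschitz vector field: the solutions exist
for all times. -/
lemma exists_forall_hasDerivAt_of_lipschitz_of_bounded {E : Type*} [NormedAddCommGroup E]
    [NormedSpace ℝ E] [CompleteSpace E] {F : ℝ → E → E} {K L : ℝ≥0}
    (hlip : ∀ t, LipschitzWith K (F t)) (hcont : ∀ x, Continuous fun t => F t x)
    (hbd : ∀ t x, ‖F t x‖ ≤ L) (t₀ : ℝ) (x₀ : E) :
    ∃ α : ℝ → E, α t₀ = x₀ ∧ ∀ t, HasDerivAt α (F t (α t)) t := by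
  have hloc : ∀ N : ℕ, ∃ α : ℝ → E, α t₀ = x₀ ∧
      ∀ t ∈ Ioo (t₀ - (N + 1)) (t₀ + (N + 1)), HasDerivAt α (F t (α t)) t := by
    intro N
    have hN : (0 : ℝ) ≤ N := N.cast_nonneg
    have hpl : IsPicardLindelof F (tmin := t₀ - (N + 1)) (tmax := t₀ + (N + 1))
        ⟨t₀, by constructor <;> linarith⟩ x₀ (L * (N + 1)) 0 L K :=
      { lipschitzOnWith := fun t _ => (hlip t).lipschitzOnWith
        continuousOn := fun x _ => (hcont x).continuousOn
        norm_le := fun t _ x _ => hbd t x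
        mul_max_le := by
          simp }
    obtain ⟨α, h0, h1⟩ := hpl.exists_eq_forall_mem_Icc_hasDerivWithinAt₀
    exact ⟨α, h0, fun t ht => (h1 t (Ioo_subset_Icc_self ht)).hasDerivAt (Icc_mem_nhds ht.1 ht.2)⟩
  choose α hα0 hα using hloc
  have hagree : ∀ M N : ℕ, M ≤ N → EqOn (α M) (α N) (Ioo (t₀ - (M + 1)) (t₀ + (M + 1))) := by
    intro M N hMN
    have hM : (0 : ℝ) ≤ M := M.cast_nonneg
    have hMN' : (M : ℝ) ≤ N := by exact_mod_cast hMN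
    refine ODE_solution_unique_of_mem_Ioo (v := F) (s := fun _ => univ) (K := K) (t₀ := t₀)
      (fun t _ => (hlip t).lipschitzOnWith) ⟨by linarith, by linarith⟩
      (fun t ht => ⟨hα M t ht, trivial⟩)
      (fun t ht => ⟨hα N t ⟨by linarith [ht.1], by linarith [ht.2]⟩, trivial⟩)
      ((hα0 M).trans (hα0 N).symm)
  -- The solutions on the growing intervals agree, so they can be glued along `⌈|t - t₀|⌉`.
  refine ⟨fun t => α ⌈|t - t₀|⌉₊ t, by simp [hα0], fun t => ?_⟩
  set N := ⌈|t - t₀|⌉₊ with hN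
  have hloc : ∀ᶠ s in 𝓝 t, α ⌈|s - t₀|⌉₊ s = α (N + 1) s := by
    have : ∀ᶠ s in 𝓝 t, |s - t₀| < N + 1 := by
      have hc : Continuous fun s : ℝ => |s - t₀| := by fun_prop
      exact hc.continuousAt.eventually_lt_const
        (lt_of_le_of_lt (Nat.le_ceil _) (lt_add_one _))
    filter_upwards [this] with s hs
    have h1 : ⌈|s - t₀|⌉₊ ≤ N + 1 := by
      rw [Nat.ceil_le]
      push_cast
      exact hs.le
    refine hagree _ _ h1 ?_
    have h2 := Nat.le_ceil |s - t₀|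
    have h3 := abs_le.mp h2
    constructor <;> linarith [h3.1, h3.2]
  have hd : HasDerivAt (α (N + 1)) (F t (α (N + 1) t)) t := by
    refine hα (N + 1) t ?_
    have h3 := abs_le.mp (Nat.le_ceil |t - t₀|)
    push_cast
    constructor <;> linarith [h3.1, h3.2]
  have ht : α N t = α (N + 1) t := hloc.self_of_nhds
  simp only [← hN]
  rw [ht]
  exact hd.congr_of_eventuallyEq hloc

/-- `θ` is a Prüfer angle of `-∂² + U` at the energy `E`: the polar angle of the point `(u', u)` of
the phase plane, for a solution `u` of `-u'' + U u = E u`. It is defined by the first-order equation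
`θ' = cos² θ + (E - U) sin² θ`, with `cos²` eliminated. -/
def IsPruferAngle (U : ℝ → ℝ) (E : ℝ) (θ : ℝ → ℝ) : Prop :=
  ∀ x, HasDerivAt θ (1 + (E - U x - 1) * Real.sin (θ x) ^ 2) x

lemma abs_sin_sq_sub_sin_sq_le (a b : ℝ) :
    |Real.sin a ^ 2 - Real.sin b ^ 2| ≤ 2 * |a - b| := by
  have h1 : |Real.sin a - Real.sin b| ≤ |a - b| := by
    have := Real.lipschitzWith_sin.dist_le_mul a b
    simpa [Real.dist_eq] using this
  have h2 : |Real.sin a + Real.sin b| ≤ 2 :=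
    (abs_add_le _ _).trans (by linarith [Real.abs_sin_le_one a, Real.abs_sin_le_one b])
  rw [sq_sub_sq, abs_mul]
  exact mul_le_mul h2 h1 (abs_nonneg _) (by norm_num)

open scoped NNReal in
lemma lipschitzWith_pruferField {U : ℝ → ℝ} {M : ℝ≥0} (hM : ∀ x, |U x| ≤ M) (E t : ℝ) :
    LipschitzWith (2 * (‖E‖₊ + M + 1)) fun θ => 1 + (E - U t - 1) * Real.sin θ ^ 2 := by
  refine LipschitzWith.of_dist_le_mul fun a b => ?_
  rw [Real.dist_eq, Real.dist_eq, add_sub_add_left_eq_sub, ← mul_sub, abs_mul]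
  have h1 : |E - U t - 1| ≤ |E| + M + 1 := by
    have h2 := abs_sub (E - U t) 1
    have h3 := abs_sub E (U t)
    rw [abs_one] at h2
    linarith [hM t]
  have := abs_sin_sq_sub_sin_sq_le a b
  push_cast
  rw [Real.norm_eq_abs]
  calc _ ≤ (|E| + M + 1) * (2 * |a - b|) :=
        mul_le_mul h1 this (abs_nonneg _) (by positivity)
    _ = _ := by ring

open scoped NNReal in
lemma exists_isPruferAngle {U : ℝ → ℝ} {M : ℝ≥0} (hU : Continuous U) (hM : ∀ x, |U x| ≤ M)
    (E x₀ a : ℝ) : ∃ θ, IsPruferAngle U E θ ∧ θ x₀ = a := by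
  obtain ⟨θ, h0, h1⟩ := exists_forall_hasDerivAt_of_lipschitz_of_bounded
    (F := fun t θ => 1 + (E - U t - 1) * Real.sin θ ^ 2) (L := 1 + (‖E‖₊ + M + 1))
    (lipschitzWith_pruferField hM E) (fun x => by fun_prop) (fun t x => by
      have h1 : |E - U t - 1| ≤ |E| + M + 1 := by
        have h2 := abs_sub (E - U t) 1
        have h3 := abs_sub E (U t)
        rw [abs_one] at h2
        linarith [hM t]
      have h4 : |Real.sin x ^ 2| ≤ 1 := by
        rw [abs_of_nonneg (sq_nonneg _)]
        exact Real.sin_sq_le_one x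
      refine (norm_add_le _ _).trans ?_
      rw [norm_mul, norm_one]
      push_cast
      simp only [Real.norm_eq_abs]
      have := mul_le_mul h1 h4 (abs_nonneg _) (by positivity)
      linarith) x₀ a
  exact ⟨θ, h1, h0⟩

/-- A Prüfer angle, together with the amplitude that belongs to it, gives a solution. -/
lemma IsPruferAngle.exists_solution {U : ℝ → ℝ} {E : ℝ} {θ : ℝ → ℝ} (hU : Continuous U)
    (hθ : IsPruferAngle U E θ) (x₀ C : ℝ) : ∃ A : ℝ → ℝ, A x₀ = 0 ∧
      (∀ x, HasDerivAt (fun x => C * Real.exp (A x) * Real.sin (θ x))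
        (C * Real.exp (A x) * Real.cos (θ x)) x) ∧
      ∀ x, HasDerivAt (fun x => C * Real.exp (A x) * Real.cos (θ x))
        ((U x - E) * (C * Real.exp (A x) * Real.sin (θ x))) x := by
  have hθc : Continuous θ := continuous_iff_continuousAt.mpr fun x => (hθ x).continuousAt
  have hc : Continuous fun x => (1 + U x - E) * Real.sin (θ x) * Real.cos (θ x) := by fun_prop
  have hA : ∀ x, HasDerivAt (fun x => ∫ t in x₀..x, (1 + U t - E) * Real.sin (θ t) * Real.cos (θ t))
      ((1 + U x - E) * Real.sin (θ x) * Real.cos (θ x)) x := fun x =>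
    intervalIntegral.integral_hasDerivAt_right (hc.intervalIntegrable _ _)
      hc.aestronglyMeasurable.stronglyMeasurableAtFilter hc.continuousAt
  refine ⟨fun x => ∫ t in x₀..x, (1 + U t - E) * Real.sin (θ t) * Real.cos (θ t), by simp,
    fun x => ?_, fun x => ?_⟩
  · refine (((hA x).exp.const_mul C).mul (hθ x).sin).congr_deriv ?_
    ring
  · refine (((hA x).exp.const_mul C).mul (hθ x).cos).congr_deriv ?_
    have : Real.cos (θ x) * Real.cos (θ x) = 1 - Real.sin (θ x) ^ 2 := by
      rw [← sq, Real.cos_sq']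
    linear_combination (C * Real.exp (∫ t in x₀..x, (1 + U t - E) * Real.sin (θ t) * Real.cos (θ t))
      * (1 + U x - E) * Real.sin (θ x)) * this

open scoped NNReal in
/-- The initial value problem of `-u'' + U u = E u`, for a bounded continuous potential, has a
solution on the whole line. -/
lemma exists_solution_of_initial_values {U : ℝ → ℝ} {M : ℝ≥0} (hU : Continuous U)
    (hM : ∀ x, |U x| ≤ M) (E x₀ a b : ℝ) : ∃ u u' : ℝ → ℝ, u x₀ = a ∧ u' x₀ = b ∧
      (∀ x, HasDerivAt u (u' x) x) ∧ ∀ x, HasDerivAt u' ((U x - E) * u x) x := by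
  obtain ⟨θ, hθ, h0⟩ := exists_isPruferAngle hU hM E x₀ (Complex.arg ⟨b, a⟩)
  obtain ⟨A, hA0, h1, h2⟩ := hθ.exists_solution hU x₀ ‖(⟨b, a⟩ : ℂ)‖
  refine ⟨_, _, ?_, ?_, h1, h2⟩
  · rw [hA0, Real.exp_zero, mul_one, h0, Complex.norm_mul_sin_arg]
  · rw [hA0, Real.exp_zero, mul_one, h0, Complex.norm_mul_cos_arg]

open scoped NNReal in
/-- Two solutions of `-u'' + U u = E u` with the same initial values agree. -/
lemma solution_eqOn_of_initial_values {U : ℝ → ℝ} {M : ℝ≥0} (hM : ∀ x, |U x| ≤ M) {E : ℝ}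
    {a b x₀ : ℝ} (hx₀ : x₀ ∈ Ioo a b) {u u' w w' : ℝ → ℝ}
    (hu : ∀ x ∈ Ioo a b, HasDerivAt u (u' x) x)
    (hu' : ∀ x ∈ Ioo a b, HasDerivAt u' ((U x - E) * u x) x)
    (hw : ∀ x ∈ Ioo a b, HasDerivAt w (w' x) x)
    (hw' : ∀ x ∈ Ioo a b, HasDerivAt w' ((U x - E) * w x) x)
    (h0 : u x₀ = w x₀) (h0' : u' x₀ = w' x₀) :
    EqOn u w (Ioo a b) ∧ EqOn u' w' (Ioo a b) := by
  have hlip : ∀ t, LipschitzWith (max 1 (M + ‖E‖₊))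
      fun p : ℝ × ℝ => (p.2, (U t - E) * p.1) := by
    intro t
    refine LipschitzWith.prodMk (LipschitzWith.prod_snd) ?_
    refine LipschitzWith.of_dist_le_mul fun p q => ?_
    rw [Real.dist_eq, ← mul_sub, abs_mul]
    have h1 : |U t - E| ≤ M + |E| := (abs_sub _ _).trans (by linarith [hM t])
    have h2 : |p.1 - q.1| ≤ dist p q := by
      rw [← Real.dist_eq, Prod.dist_eq]
      exact le_max_left _ _
    push_cast
    rw [Real.norm_eq_abs]
    exact mul_le_mul h1 h2 (abs_nonneg _) (by positivity)
  have := ODE_solution_unique_of_mem_Ioo (v := fun t (p : ℝ × ℝ) => (p.2, (U t - E) * p.1))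
    (s := fun _ => univ) (f := fun x => (u x, u' x)) (g := fun x => (w x, w' x))
    (fun t _ => (hlip t).lipschitzOnWith) hx₀
    (fun t ht => ⟨(hu t ht).prodMk (hu' t ht), trivial⟩)
    (fun t ht => ⟨(hw t ht).prodMk (hw' t ht), trivial⟩) (by simp [h0, h0'])
  exact ⟨fun x hx => congrArg Prod.fst (this hx), fun x hx => congrArg Prod.snd (this hx)⟩

/-! ### Sturm's oscillation theorem -/

/-- The integrating factor of the linear equation `w' = a w + b`. -/
lemma exists_integrating_factor {w a b : ℝ → ℝ} (ha : Continuous a)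
    (hw : ∀ x, HasDerivAt w (a x * w x + b x) x) :
    ∃ e : ℝ → ℝ, (∀ x, 0 < e x) ∧ ∀ x, HasDerivAt (fun x => e x * w x) (e x * b x) x := by
  have hA : ∀ x, HasDerivAt (fun x => ∫ t in (0 : ℝ)..x, a t) (a x) x := fun x =>
    intervalIntegral.integral_hasDerivAt_right (ha.intervalIntegrable _ _)
      ha.aestronglyMeasurable.stronglyMeasurableAtFilter ha.continuousAt
  refine ⟨fun x => Real.exp (-∫ t in (0 : ℝ)..x, a t), fun x => Real.exp_pos _, fun x => ?_⟩
  exact ((hA x).fun_neg.exp.fun_mul (hw x)).congr_deriv (by ring)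

lemma sin_eq_sinc_mul (x : ℝ) : Real.sin x = Real.sinc x * x := by
  by_cases hx : x = 0
  · simp [hx]
  · rw [Real.sinc_of_ne_zero hx, div_mul_cancel₀ _ hx]

lemma IsPruferAngle.continuous {U : ℝ → ℝ} {E : ℝ} {θ : ℝ → ℝ} (hθ : IsPruferAngle U E θ) :
    Continuous θ :=
  continuous_iff_continuousAt.mpr fun x => (hθ x).continuousAt

/-- A Prüfer angle crosses the multiples of `π` upwards only: near such a multiple it satisfies
`w' = 1 + c w` for a continuous function `c`. -/
lemma IsPruferAngle.int_mul_pi_lt {U : ℝ → ℝ} {E : ℝ} {θ : ℝ → ℝ} (hU : Continuous U)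
    (hθ : IsPruferAngle U E θ) {k : ℤ} {x₀ x : ℝ} (hx₀ : θ x₀ = k * Real.pi) (hx : x₀ < x) :
    k * Real.pi < θ x := by
  have hc := hθ.continuous
  obtain ⟨e, he, hd⟩ := exists_integrating_factor (w := fun x => θ x - k * Real.pi)
    (a := fun x => (E - U x - 1) * Real.sin (θ x - k * Real.pi) *
      Real.sinc (θ x - k * Real.pi)) (b := fun _ => 1)
    (by have := Real.continuous_sinc; fun_prop) (fun x => by
      refine ((hθ x).sub_const _).congr_deriv ?_
      have h1 : Real.sin (θ x) ^ 2 = Real.sin (θ x - k * Real.pi) ^ 2 := by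
        rw [Real.sin_sub_int_mul_pi, mul_pow, ← zpow_natCast ((-1 : ℝ) ^ k), ← zpow_mul, mul_comm k,
          zpow_mul]
        simp
      rw [h1]
      linear_combination ((E - U x - 1) * Real.sin (θ x - k * Real.pi)) *
        sin_eq_sinc_mul (θ x - k * Real.pi))
  have hmono : StrictMono fun x => e x * (θ x - k * Real.pi) :=
    strictMono_of_hasDerivAt_pos hd fun x => by simpa using he x
  have h1 := hmono hx
  simp only [hx₀, sub_self, mul_zero] at h1
  linarith [(pos_iff_pos_of_mul_pos h1).mp (he x)]

/-- The Prüfer angle at the end of the interval is strictly increasing in the energy. -/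
lemma IsPruferAngle.lt_of_lt {U : ℝ → ℝ} {E₁ E₂ : ℝ} {θ₁ θ₂ : ℝ → ℝ} (hU : Continuous U)
    (h₁ : IsPruferAngle U E₁ θ₁) (h₂ : IsPruferAngle U E₂ θ₂) (h0 : θ₁ 0 = 0) (h0' : θ₂ 0 = 0)
    (hE : E₁ < E₂) {T : ℝ} (hT : 0 < T) : θ₁ T < θ₂ T := by
  have hc₁ := h₁.continuous
  have hc₂ := h₂.continuous
  obtain ⟨e, he, hd⟩ := exists_integrating_factor (w := fun x => θ₂ x - θ₁ x)
    (a := fun x => (E₁ - U x - 1) * Real.sin (θ₂ x + θ₁ x) * Real.sinc (θ₂ x - θ₁ x))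
    (b := fun x => (E₂ - E₁) * Real.sin (θ₂ x) ^ 2)
    (by have := Real.continuous_sinc; fun_prop) (fun x => by
      refine ((h₂ x).sub (h₁ x)).congr_deriv ?_
      have h3 : Real.sin (θ₂ x) ^ 2 - Real.sin (θ₁ x) ^ 2 =
          Real.sin (θ₂ x + θ₁ x) * Real.sin (θ₂ x - θ₁ x) := by
        rw [Real.sin_add, Real.sin_sub]
        linear_combination Real.sin (θ₁ x) ^ 2 * Real.sin_sq_add_cos_sq (θ₂ x) -
          Real.sin (θ₂ x) ^ 2 * Real.sin_sq_add_cos_sq (θ₁ x)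
      linear_combination (E₁ - U x - 1) * h3 + (E₁ - U x - 1) * Real.sin (θ₂ x + θ₁ x) *
        sin_eq_sinc_mul (θ₂ x - θ₁ x))
  have hmono : Monotone fun x => e x * (θ₂ x - θ₁ x) :=
    monotone_of_hasDerivAt_nonneg hd fun x =>
      mul_nonneg (he x).le (mul_nonneg (sub_pos.mpr hE).le (sq_nonneg _))
  have hge := hmono hT.le
  simp only [h0, h0', sub_self, mul_zero] at hge
  rcases hge.lt_or_eq with h | h
  · linarith [(pos_iff_pos_of_mul_pos h).mp (he T)]
  · exfalso
    -- Equality would force `sin θ₂ = 0` on the whole interval, but `θ₂` leaves `0` with speed `1`.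
    have hzero : ∀ x ∈ Ioo 0 T, Real.sin (θ₂ x) = 0 := by
      intro x hx
      have hev : (fun x => e x * (θ₂ x - θ₁ x)) =ᶠ[𝓝 x] fun _ => 0 := by
        filter_upwards [Ioo_mem_nhds hx.1 hx.2] with y hy
        refine le_antisymm ?_ ?_
        · have := hmono hy.2.le
          simp only at this
          linarith
        · have := hmono hy.1.le
          simp only [h0, h0', sub_self, mul_zero] at this
          exact this
      have h4 := (hd x).unique ((hasDerivAt_const x (0 : ℝ)).congr_of_eventuallyEq hev)
      have h5 : Real.sin (θ₂ x) ^ 2 = 0 := by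
        rcases mul_eq_zero.mp h4 with h | h
        · exact absurd h (he x).ne'
        · exact (mul_eq_zero.mp h).resolve_left (sub_pos.mpr hE).ne'
      exact pow_eq_zero_iff (two_ne_zero) |>.mp h5
    have hx : T / 2 ∈ Ioo 0 T := ⟨by linarith, by linarith⟩
    have hev : (fun x => Real.sin (θ₂ x)) =ᶠ[𝓝 (T / 2)] fun _ => 0 := by
      filter_upwards [Ioo_mem_nhds hx.1 hx.2] with y hy using hzero y hy
    have h6 := (h₂ (T / 2)).sin.unique
      ((hasDerivAt_const (T / 2) (0 : ℝ)).congr_of_eventuallyEq hev)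
    rw [hzero _ hx] at h6
    have h7 := Real.sin_sq_add_cos_sq (θ₂ (T / 2))
    rw [hzero _ hx] at h7
    simp at h6
    rw [h6] at h7
    norm_num at h7

/-- Below the minimum of the potential the Prüfer angle does not get past `π / 2`. -/
lemma IsPruferAngle.le_pi_div_two {U : ℝ → ℝ} {E : ℝ} {θ : ℝ → ℝ}
    (hθ : IsPruferAngle U E θ) (h0 : θ 0 = 0) (hE : ∀ x, E ≤ U x) {T : ℝ} (hT : 0 ≤ T) :
    θ T ≤ Real.pi / 2 := by
  have hc := hθ.continuous
  obtain ⟨e, he, hd⟩ := exists_integrating_factor (w := fun x => Real.pi / 2 - θ x)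
    (a := fun x => -Real.sin (Real.pi / 2 - θ x) * Real.sinc (Real.pi / 2 - θ x))
    (b := fun x => (U x - E) * Real.sin (θ x) ^ 2)
    (by have := Real.continuous_sinc; fun_prop) (fun x => by
      refine ((hθ x).const_sub _).congr_deriv ?_
      have h1 := sin_eq_sinc_mul (Real.pi / 2 - θ x)
      rw [Real.sin_pi_div_two_sub] at h1 ⊢
      linear_combination Real.sin_sq_add_cos_sq (θ x) - Real.cos (θ x) * h1)
  have hmono : Monotone fun x => e x * (Real.pi / 2 - θ x) :=
    monotone_of_hasDerivAt_nonneg hd fun x =>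
      mul_nonneg (he x).le (mul_nonneg (sub_nonneg.mpr (hE x)) (sq_nonneg _))
  have h1 := hmono hT
  simp only [h0, sub_zero] at h1
  have h2 : 0 < e 0 * (Real.pi / 2) := mul_pos (he 0) (by positivity)
  have h3 := (pos_iff_pos_of_mul_pos (h2.trans_le h1)).mp (he T)
  linarith

/-- The lift of `arctan (k tan θ)` to the line grows along a Prüfer angle with speed at least `k`
if `E - U ≥ k ^ 2`. Since the lift stays within `π / 2` of the angle, the angle gets arbitrarily
large at large energies. -/
lemma IsPruferAngle.mul_sub_le {U : ℝ → ℝ} {E k : ℝ} {θ : ℝ → ℝ}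
    (hθ : IsPruferAngle U E θ) (h0 : θ 0 = 0) (hk : 0 < k) (hE : ∀ x, k ^ 2 ≤ E - U x)
    {T : ℝ} (hT : 0 ≤ T) : k * T - Real.pi / 2 ≤ θ T := by
  have hpos : ∀ t : ℝ, 0 < Real.cos t ^ 2 + k * Real.sin t ^ 2 := by
    intro t
    have h1 := Real.sin_sq_add_cos_sq t
    by_contra h
    nlinarith [sq_nonneg (Real.sin t), sq_nonneg (Real.cos t),
      mul_nonneg hk.le (sq_nonneg (Real.sin t))]
  have hpos' : ∀ t : ℝ, 0 < Real.cos t ^ 2 + k ^ 2 * Real.sin t ^ 2 := by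
    intro t
    have h1 := Real.sin_sq_add_cos_sq t
    have h2 : 0 < k ^ 2 := by positivity
    by_contra h
    nlinarith [sq_nonneg (Real.sin t), sq_nonneg (Real.cos t),
      mul_nonneg h2.le (sq_nonneg (Real.sin t))]
  have hG : ∀ t, HasDerivAt (fun t => t + Real.arctan ((k - 1) * Real.sin t * Real.cos t /
      (Real.cos t ^ 2 + k * Real.sin t ^ 2)))
      (k / (Real.cos t ^ 2 + k ^ 2 * Real.sin t ^ 2)) t := by
    intro t
    have hnum : HasDerivAt (fun t => (k - 1) * Real.sin t * Real.cos t)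
        ((k - 1) * (Real.cos t ^ 2 - Real.sin t ^ 2)) t :=
      (((Real.hasDerivAt_sin t).const_mul (k - 1)).mul (Real.hasDerivAt_cos t)).congr_deriv
        (by ring)
    have hden : HasDerivAt (fun t => Real.cos t ^ 2 + k * Real.sin t ^ 2)
        (2 * (k - 1) * Real.sin t * Real.cos t) t :=
      (((Real.hasDerivAt_cos t).pow 2).add
        (((Real.hasDerivAt_sin t).pow 2).const_mul k)).congr_deriv
        (by push_cast; ring)
    refine ((hasDerivAt_id t).add (hnum.fun_div hden (hpos t).ne').arctan).congr_deriv ?_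
    have h1 := (hpos t).ne'
    have h2 := (hpos' t).ne'
    have h3 := Real.sin_sq_add_cos_sq t
    set s := Real.sin t
    set c := Real.cos t
    have h4 : 1 + ((k - 1) * s * c / (c ^ 2 + k * s ^ 2)) ^ 2 =
        (c ^ 2 + k ^ 2 * s ^ 2) / (c ^ 2 + k * s ^ 2) ^ 2 := by
      field_simp
      linear_combination (c ^ 2 + k ^ 2 * s ^ 2) * h3
    rw [h4]
    field_simp
    linear_combination (k + (k - 1) * (c ^ 2 - k * s ^ 2)) * h3
  have hd := fun x => (hG (θ x)).comp x (hθ x)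
  have hge : ∀ x, k ≤ k / (Real.cos (θ x) ^ 2 + k ^ 2 * Real.sin (θ x) ^ 2) *
      (1 + (E - U x - 1) * Real.sin (θ x) ^ 2) := by
    intro x
    rw [div_mul_eq_mul_div, le_div_iff₀ (hpos' _)]
    have h1 : Real.cos (θ x) ^ 2 + k ^ 2 * Real.sin (θ x) ^ 2 ≤
        1 + (E - U x - 1) * Real.sin (θ x) ^ 2 := by
      have h3 := Real.sin_sq_add_cos_sq (θ x)
      nlinarith [mul_le_mul_of_nonneg_right (hE x) (sq_nonneg (Real.sin (θ x)))]
    exact mul_le_mul_of_nonneg_left h1 hk.le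
  have hmono : Monotone fun x => (θ x + Real.arctan ((k - 1) * Real.sin (θ x) * Real.cos (θ x) /
      (Real.cos (θ x) ^ 2 + k * Real.sin (θ x) ^ 2))) - k * x :=
    monotone_of_hasDerivAt_nonneg (fun x => (hd x).sub ((hasDerivAt_id x).const_mul k))
      fun x => by simpa using hge x
  have h1 := hmono hT
  simp only [h0] at h1
  simp at h1
  have h2 := Real.arctan_lt_pi_div_two ((k - 1) * Real.sin (θ T) * Real.cos (θ T) /
      (Real.cos (θ T) ^ 2 + k * Real.sin (θ T) ^ 2))
  linarith

open scoped NNReal in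
/-- The Prüfer angle at a given point depends continuously on the energy. -/
lemma continuous_pruferAngle {U : ℝ → ℝ} {M : ℝ≥0} (hM : ∀ x, |U x| ≤ M) {θ : ℝ → ℝ → ℝ}
    (hθ : ∀ E, IsPruferAngle U E (θ E)) (h0 : ∀ E, θ E 0 = 0) {T : ℝ} (hT : 0 ≤ T) :
    Continuous fun E => θ E T := by
  rw [continuous_iff_continuousAt]
  intro E
  have key : ∀ E', dist (θ E' T) (θ E T) ≤
      gronwallBound 0 (2 * (‖E‖₊ + M + 1) : ℝ≥0) (|E' - E| + 0) (T - 0) := by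
    intro E'
    refine dist_le_of_approx_trajectories_ODE
      (v := fun t θ => 1 + (E - U t - 1) * Real.sin θ ^ 2) (a := 0) (b := T)
      (fun t => lipschitzWith_pruferField hM E t) (hθ E').continuous.continuousOn
      (fun t _ => (hθ E' t).hasDerivWithinAt) (fun t _ => ?_) (hθ E).continuous.continuousOn
      (fun t _ => (hθ E t).hasDerivWithinAt) (fun t _ => ?_) (by simp [h0]) T
      (right_mem_Icc.mpr hT)
    · rw [Real.dist_eq, add_sub_add_left_eq_sub, ← sub_mul, abs_mul, abs_sq]
      have h1 : E' - U t - 1 - (E - U t - 1) = E' - E := by ring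
      rw [h1]
      exact mul_le_of_le_one_right (abs_nonneg _) (Real.sin_sq_le_one _)
    · simp
  rw [ContinuousAt, tendsto_iff_dist_tendsto_zero]
  refine squeeze_zero (fun _ => dist_nonneg) key ?_
  have hc : Continuous fun E' => gronwallBound 0 (2 * (‖E‖₊ + M + 1) : ℝ≥0) (|E' - E| + 0)
      (T - 0) := (gronwallBound_continuous_ε 0 _ (T - 0)).comp (by fun_prop)
  have := hc.tendsto E
  simpa [gronwallBound_ε0_δ0] using this

open scoped NNReal in
/-- Sturm's oscillation theorem for the Dirichlet problem on `[0, T]`: the energies at which the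
solution with `u 0 = 0`, `u' 0 = 1` vanishes at `T` form a strictly increasing sequence, and at the
`n`-th one (counted from `0`) the solution has at most `n` zeros inside the interval. -/
theorem exists_dirichlet_eigenvalues {U : ℝ → ℝ} {M : ℝ≥0} (hU : Continuous U)
    (hM : ∀ x, |U x| ≤ M) {T : ℝ} (hT : 0 < T) : ∃ (μ : ℕ → ℝ) (φ φ' : ℝ → ℝ → ℝ),
      StrictMono μ ∧ (∀ E, φ E 0 = 0 ∧ φ' E 0 = 1) ∧ (∀ E x, HasDerivAt (φ E) (φ' E x) x) ∧
      (∀ E x, HasDerivAt (φ' E) ((U x - E) * φ E x) x) ∧ (∀ E, φ E T = 0 ↔ E ∈ range μ) ∧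
      ∀ n, {x ∈ Ioo 0 T | φ (μ n) x = 0}.Finite ∧
        {x ∈ Ioo 0 T | φ (μ n) x = 0}.ncard ≤ n := by
  choose θ hθ h0 using fun E => exists_isPruferAngle hU hM E 0 0
  choose A hA0 hA1 hA2 using fun E => (hθ E).exists_solution hU 0 1
  have hpi := Real.pi_pos
  have hcont := continuous_pruferAngle hM hθ h0 hT.le
  have hmono : StrictMono fun E => θ E T := fun E₁ E₂ h =>
    (hθ E₁).lt_of_lt hU (hθ E₂) (h0 E₁) (h0 E₂) h hT
  have hθpos : ∀ E x, 0 < x → 0 < θ E x := fun E x hx => by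
    have := (hθ E).int_mul_pi_lt hU (k := 0) (x₀ := 0) (by simp [h0]) hx
    simpa using this
  have hex : ∀ n : ℕ, ∃ E, θ E T = (n + 1) * Real.pi := by
    intro n
    have hlow : θ (-M) T ≤ (n + 1) * Real.pi := by
      have := (hθ (-M)).le_pi_div_two (h0 _) (fun x => (abs_le.mp (hM x)).1) hT.le
      have hn : (0 : ℝ) ≤ n := n.cast_nonneg
      nlinarith
    obtain ⟨k, hk, hkT⟩ : ∃ k : ℝ, 0 < k ∧ (n + 1) * Real.pi ≤ k * T - Real.pi / 2 := by
      refine ⟨((n + 1) * Real.pi + Real.pi / 2) / T, by positivity, ?_⟩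
      rw [div_mul_cancel₀ _ hT.ne']
      linarith
    have hhigh : (n + 1) * Real.pi ≤ θ (k ^ 2 + M) T :=
      hkT.trans ((hθ _).mul_sub_le (h0 _) hk (fun x => by linarith [(abs_le.mp (hM x)).2]) hT.le)
    exact mem_range_of_exists_le_of_exists_ge hcont ⟨_, hlow⟩ ⟨_, hhigh⟩
  choose μ hμ using hex
  have hsin : ∀ E x, 1 * Real.exp (A E x) * Real.sin (θ E x) = 0 ↔ Real.sin (θ E x) = 0 :=
    fun E x => by simp [(Real.exp_pos _).ne']
  refine ⟨μ, fun E x => 1 * Real.exp (A E x) * Real.sin (θ E x),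
    fun E x => 1 * Real.exp (A E x) * Real.cos (θ E x), ?_, ?_, hA1, hA2, ?_, ?_⟩
  · intro m n hmn
    rw [← hmono.lt_iff_lt]
    simp only [hμ]
    have : (m : ℝ) < n := by exact_mod_cast hmn
    nlinarith
  · intro E
    simp [hA0, h0]
  · intro E
    rw [hsin, Real.sin_eq_zero_iff]
    constructor
    · rintro ⟨k, hk⟩
      have h1 := hθpos E T hT
      rw [← hk] at h1
      have h2 : 0 < k := by
        have := (pos_iff_pos_of_mul_pos h1).mpr hpi
        exact_mod_cast this
      obtain ⟨n, rfl⟩ : ∃ n : ℕ, k = n + 1 := ⟨(k - 1).toNat, by omega⟩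
      refine ⟨n, hmono.injective ?_⟩
      simp only [hμ]
      rw [← hk]
      push_cast
      ring
    · rintro ⟨n, rfl⟩
      exact ⟨n + 1, by rw [hμ]; push_cast; ring⟩
  · intro n
    -- A zero is determined by the multiple of `π` in `(0, (n + 1) π)` that the angle takes there.
    have hinj : ∃ κ : ℝ → ℤ, MapsTo κ {x ∈ Ioo 0 T | 1 * Real.exp (A (μ n) x) *
        Real.sin (θ (μ n) x) = 0} (Icc 1 (n : ℤ)) ∧
        InjOn κ {x ∈ Ioo 0 T | 1 * Real.exp (A (μ n) x) * Real.sin (θ (μ n) x) = 0} := by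
      have : ∀ x, ∃ k : ℤ, Real.sin (θ (μ n) x) = 0 → (k : ℝ) * Real.pi = θ (μ n) x := by
        intro x
        by_cases h : Real.sin (θ (μ n) x) = 0
        · obtain ⟨k, hk⟩ := Real.sin_eq_zero_iff.mp h
          exact ⟨k, fun _ => hk⟩
        · exact ⟨0, fun h' => absurd h' h⟩
      choose κ hκ using this
      refine ⟨κ, ?_, ?_⟩
      · rintro x ⟨hx, hx0⟩
        have hk := hκ x ((hsin _ _).mp hx0)
        have h1 := hθpos (μ n) x hx.1
        have h2 := (hθ (μ n)).int_mul_pi_lt hU hk.symm hx.2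
        rw [← hk] at h1
        rw [hμ] at h2
        have h3 : (0 : ℝ) < κ x := (pos_iff_pos_of_mul_pos h1).mpr hpi
        have h4 : (κ x : ℝ) < n + 1 := lt_of_mul_lt_mul_right h2 hpi.le
        have h3' : 0 < κ x := by exact_mod_cast h3
        have h4' : κ x < n + 1 := by exact_mod_cast h4
        exact ⟨by omega, by omega⟩
      · rintro x ⟨hx, hx0⟩ y ⟨hy, hy0⟩ hxy
        have hkx := hκ x ((hsin _ _).mp hx0)
        have hky := hκ y ((hsin _ _).mp hy0)
        rcases lt_trichotomy x y with h | h | h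
        · have := (hθ (μ n)).int_mul_pi_lt hU hkx.symm h
          rw [← hky, hxy] at this
          exact absurd this (lt_irrefl _)
        · exact h
        · have := (hθ (μ n)).int_mul_pi_lt hU hky.symm h
          rw [← hkx, hxy] at this
          exact absurd this (lt_irrefl _)
    obtain ⟨κ, hmaps, hinj⟩ := hinj
    refine ⟨Set.Finite.of_injOn hmaps hinj (finite_Icc _ _), ?_⟩
    refine (Set.ncard_le_ncard_of_injOn κ hmaps hinj (finite_Icc _ _)).trans ?_
    rw [Set.ncard_eq_toFinset_card']
    simp

/-! ### Darboux transformations of solutions -/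

lemma SolvesSchrodingerOn.hasDerivAt {𝕜 : Type} [RCLike 𝕜] {s : Set ℝ} {U : ℝ → ℝ} {E : 𝕜}
    {ψ : ℝ → 𝕜} (h : SolvesSchrodingerOn s U E ψ) (hs : IsOpen s) {x : ℝ} (hx : x ∈ s) :
    HasDerivAt ψ (deriv ψ x) x :=
  ((h.1.contDiffAt (hs.mem_nhds hx)).differentiableAt (by simp)).hasDerivAt

lemma SolvesSchrodingerOn.hasDerivAt_deriv {𝕜 : Type} [RCLike 𝕜] {s : Set ℝ} {U : ℝ → ℝ} {E : 𝕜}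
    {ψ : ℝ → 𝕜} (h : SolvesSchrodingerOn s U E ψ) (hs : IsOpen s) {x : ℝ} (hx : x ∈ s) :
    HasDerivAt (deriv ψ) (U x • ψ x - E * ψ x) x := by
  have h1 : ContDiffAt ℝ 1 (deriv ψ) x :=
    (h.1.contDiffAt (hs.mem_nhds hx)).derivWithin (by norm_num)
  have h2 := (h1.differentiableAt (by simp)).hasDerivAt
  have h3 := h.2 x hx
  exact h2.congr_deriv (by linear_combination -h3)

lemma SolvesSchrodingerOn.of_hasDerivAt {𝕜 : Type} [RCLike 𝕜] {s : Set ℝ} {U : ℝ → ℝ} {E : 𝕜}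
    {ψ ψ' : ℝ → 𝕜} (hs : IsOpen s) (hU : ContinuousOn U s)
    (h : ∀ x ∈ s, HasDerivAt ψ (ψ' x) x)
    (h' : ∀ x ∈ s, HasDerivAt ψ' (U x • ψ x - E * ψ x) x) : SolvesSchrodingerOn s U E ψ := by
  have heq : EqOn (deriv ψ) ψ' s := fun x hx => (h x hx).deriv
  have heq' : EqOn (deriv (deriv ψ)) (fun x => U x • ψ x - E * ψ x) s := fun x hx => by
    have : deriv ψ =ᶠ[𝓝 x] ψ' := by
      filter_upwards [hs.mem_nhds hx] with y hy using heq hy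
    rw [this.deriv_eq]
    exact (h' x hx).deriv
  refine ⟨?_, fun x hx => ?_⟩
  · rw [show (2 : ℕ∞ω) = 1 + 1 by norm_num, contDiffOn_succ_iff_deriv_of_isOpen hs]
    refine ⟨fun x hx => (h x hx).differentiableAt.differentiableWithinAt, by simp, ?_⟩
    rw [show (1 : ℕ∞ω) = 0 + 1 by norm_num, contDiffOn_succ_iff_deriv_of_isOpen hs]
    refine ⟨fun x hx => ?_, by simp, ?_⟩
    · exact ((h' x hx).differentiableAt.differentiableWithinAt).congr
        (fun y hy => heq hy) (heq hx)
    · rw [contDiffOn_zero]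
      have hψ : ContinuousOn ψ s := fun x hx => (h x hx).continuousAt.continuousWithinAt
      exact ((hU.smul hψ).sub (continuousOn_const.mul hψ)).congr heq'
  · rw [heq' hx]
    ring

lemma SolvesSchrodingerOn.mono {𝕜 : Type} [RCLike 𝕜] {s t : Set ℝ} {U : ℝ → ℝ} {E : 𝕜}
    {ψ : ℝ → 𝕜} (h : SolvesSchrodingerOn s U E ψ) (hts : t ⊆ s) : SolvesSchrodingerOn t U E ψ :=
  ⟨h.1.mono hts, fun x hx => h.2 x (hts hx)⟩

/-- A solution with values in `ℝ` is one with values in `ℂ`. -/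
lemma SolvesSchrodingerOn.ofReal {s : Set ℝ} {U : ℝ → ℝ} {E : ℝ} {ψ : ℝ → ℝ}
    (h : SolvesSchrodingerOn s U E ψ) (hs : IsOpen s) (hU : ContinuousOn U s) :
    SolvesSchrodingerOn s U (E : ℂ) fun x => (ψ x : ℂ) := by
  refine .of_hasDerivAt (ψ' := fun x => ((deriv ψ x : ℝ) : ℂ)) hs hU
    (fun x hx => (h.hasDerivAt hs hx).ofReal_comp) (fun x hx => ?_)
  refine (h.hasDerivAt_deriv hs hx).ofReal_comp.congr_deriv ?_
  simp

/-- `v` and `dv = v'` form a Darboux pair for `U` at the energy `E₀` on `s`, with the transform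
`V`: the operators `-∂² + U - E₀` and `-∂² + V - E₀` are the products of `∂ - v` and `-(∂ + v)` in
the two orders. -/
structure IsDarbouxPair (s : Set ℝ) (U V : ℝ → ℝ) (E₀ : ℝ) (v dv : ℝ → ℝ) : Prop where
  hasDerivAt : ∀ x ∈ s, HasDerivAt v (dv x) x
  riccati : ∀ x ∈ s, dv x = U x - E₀ - v x ^ 2
  eq_sub : ∀ x ∈ s, V x = U x - 2 * dv x

/-- The Darboux transformation is undone by the one with `-v`. -/
lemma IsDarbouxPair.symm {s : Set ℝ} {U V : ℝ → ℝ} {E₀ : ℝ} {v dv : ℝ → ℝ}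
    (h : IsDarbouxPair s U V E₀ v dv) :
    IsDarbouxPair s V U E₀ (fun x => -v x) (fun x => -dv x) where
  hasDerivAt x hx := (h.hasDerivAt x hx).fun_neg
  riccati x hx := by
    have := h.riccati x hx
    have := h.eq_sub x hx
    linarith
  eq_sub x hx := by
    have := h.eq_sub x hx
    linarith

lemma IsDarbouxPair.mono {s t : Set ℝ} {U V : ℝ → ℝ} {E₀ : ℝ} {v dv : ℝ → ℝ}
    (h : IsDarbouxPair s U V E₀ v dv) (hts : t ⊆ s) : IsDarbouxPair t U V E₀ v dv :=
  ⟨fun x hx => h.1 x (hts hx), fun x hx => h.2 x (hts hx), fun x hx => h.3 x (hts hx)⟩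

/-- The factorization `(∂ + v) (∂ - v) = E₀ - E` on the solutions for the energy `E`. -/
lemma IsDarbouxPair.hasDerivAt_transform {𝕜 : Type} [RCLike 𝕜] {s : Set ℝ} {U V : ℝ → ℝ} {E₀ : ℝ}
    {v dv : ℝ → ℝ} (h : IsDarbouxPair s U V E₀ v dv) (hs : IsOpen s) {E : 𝕜} {ψ : ℝ → 𝕜}
    (hψ : SolvesSchrodingerOn s U E ψ) {x : ℝ} (hx : x ∈ s) :
    HasDerivAt (fun x => deriv ψ x - v x • ψ x)
      (((E₀ : 𝕜) - E) * ψ x - v x • (deriv ψ x - v x • ψ x)) x := by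
  refine ((hψ.hasDerivAt_deriv hs hx).sub
    ((h.hasDerivAt x hx).smul (hψ.hasDerivAt hs hx))).congr_deriv ?_
  have h1 := congrArg (fun t : ℝ => (t : 𝕜)) (h.riccati x hx)
  simp only [RCLike.ofReal_sub, RCLike.ofReal_pow] at h1
  simp only [RCLike.real_smul_eq_coe_mul]
  linear_combination -ψ x * h1

lemma IsDarbouxPair.solves_transform {𝕜 : Type} [RCLike 𝕜] {s : Set ℝ} {U V : ℝ → ℝ} {E₀ : ℝ}
    {v dv : ℝ → ℝ} (h : IsDarbouxPair s U V E₀ v dv) (hs : IsOpen s) (hV : ContinuousOn V s)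
    {E : 𝕜} {ψ : ℝ → 𝕜} (hψ : SolvesSchrodingerOn s U E ψ) :
    SolvesSchrodingerOn s V E fun x => deriv ψ x - v x • ψ x := by
  refine .of_hasDerivAt hs hV (fun x hx => h.hasDerivAt_transform hs hψ hx) fun x hx => ?_
  refine (((hψ.hasDerivAt hs hx).const_mul _).sub
    ((h.hasDerivAt x hx).smul (h.hasDerivAt_transform hs hψ hx))).congr_deriv ?_
  have h1 := congrArg (fun t : ℝ => (t : 𝕜)) (h.riccati x hx)
  have h2 := congrArg (fun t : ℝ => (t : 𝕜)) (h.eq_sub x hx)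
  simp only [RCLike.ofReal_sub, RCLike.ofReal_pow, RCLike.ofReal_mul, RCLike.ofReal_ofNat] at h1 h2
  simp only [RCLike.real_smul_eq_coe_mul]
  linear_combination (deriv ψ x - v x * ψ x) * (h1 - h2)

/-! ### Solutions near a singular end point -/

/-- If a solution of `f'' = (m (m + 1) / x² + c) f` with bounded `c` and `m ≥ 1` tends to `0` at the
singular point, then so do `f x / x` and `f'`. With `p = f' + m f / x` the equation becomes
the pair `(p / x ^ m)' = c f / x ^ m`, `(x ^ m f)' = x ^ m p`. -/
lemma tendsto_deriv_of_tendsto_zero {m : ℕ} (hm : 1 ≤ m) {f f' c : ℝ → ℝ} {δ C : ℝ} (hδ : 0 < δ)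
    (hf : ∀ x ∈ Ioo 0 δ, HasDerivAt f (f' x) x)
    (hf' : ∀ x ∈ Ioo 0 δ, HasDerivAt f' ((m * (m + 1) / x ^ 2 + c x) * f x) x)
    (hc : ∀ x ∈ Ioo 0 δ, |c x| ≤ C) (h0 : Tendsto f (𝓝[>] 0) (𝓝 0)) :
    Tendsto f' (𝓝[>] 0) (𝓝 0) ∧ Tendsto (fun x => f x / x) (𝓝[>] 0) (𝓝 0) := by
  have hp : ∀ x ∈ Ioo 0 δ, HasDerivAt (fun x => (f' x + m / x * f x) / x ^ m)
      (c x * f x / x ^ m) x := by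
    intro x hx
    have hx0 : x ≠ 0 := hx.1.ne'
    have h1 : HasDerivAt (fun x : ℝ => (m : ℝ) / x) (-(m : ℝ) / x ^ 2) x := by
      refine ((hasDerivAt_inv hx0).const_mul (m : ℝ)).congr_deriv ?_
      ring
    refine (((hf' x hx).fun_add (h1.fun_mul (hf x hx))).fun_div (hasDerivAt_pow m x)
      (pow_ne_zero m hx0)).congr_deriv ?_
    obtain ⟨k, rfl⟩ : ∃ k, m = k + 1 := ⟨m - 1, by omega⟩
    simp only [Nat.add_sub_cancel]
    push_cast
    field_simp
    ring
  have hH : ∀ x ∈ Ioo 0 δ, HasDerivAt (fun x => x ^ m * f x) (x ^ m * (f' x + m / x * f x)) x := by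
    intro x hx
    have hx0 : x ≠ 0 := hx.1.ne'
    refine ((hasDerivAt_pow m x).fun_mul (hf x hx)).congr_deriv ?_
    obtain ⟨k, rfl⟩ : ∃ k, m = k + 1 := ⟨m - 1, by omega⟩
    simp only [Nat.add_sub_cancel]
    push_cast
    field_simp
    ring
  have hC : 0 ≤ C := (abs_nonneg _).trans (hc (δ / 2) ⟨by linarith, by linarith⟩)
  have hp0 : Tendsto (fun x => f' x + m / x * f x) (𝓝[>] 0) (𝓝 0) := by
    rw [Metric.tendsto_nhds]
    intro ε hε
    obtain ⟨x₁, hx₁, hfx₁⟩ : ∃ x₁ > 0, ∀ x ∈ Ioc 0 x₁, x < δ ∧ x ≤ 1 ∧ |c x * f x| ≤ ε / 2 := by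
      have h1 : ∀ᶠ x in 𝓝[>] (0 : ℝ), x < δ ∧ x ≤ 1 ∧ |c x * f x| ≤ ε / 2 := by
        have h2 := (Metric.tendsto_nhds.mp h0) (ε / 2 / (C + 1)) (by positivity)
        filter_upwards [h2, self_mem_nhdsWithin,
          nhdsWithin_le_nhds (Iio_mem_nhds hδ), nhdsWithin_le_nhds (Iio_mem_nhds one_pos)]
          with x hx hx0 hxδ hx1
        refine ⟨hxδ, le_of_lt hx1, ?_⟩
        rw [Real.dist_eq, sub_zero, lt_div_iff₀ (by positivity)] at hx
        rw [abs_mul]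
        have := mul_le_mul_of_nonneg_right (hc x ⟨hx0, hxδ⟩) (abs_nonneg (f x))
        nlinarith [abs_nonneg (f x)]
      rw [eventually_nhdsWithin_iff, Metric.eventually_nhds_iff] at h1
      obtain ⟨r, hr, h1⟩ := h1
      refine ⟨r / 2, by positivity, fun x hx => h1 ?_ hx.1⟩
      rw [Real.dist_eq, sub_zero, abs_of_pos hx.1]
      linarith [hx.2]
    have hδ₁ := (hfx₁ x₁ ⟨hx₁, le_rfl⟩).1
    have h11 := (hfx₁ x₁ ⟨hx₁, le_rfl⟩).2.1
    have hlim : Tendsto (fun x : ℝ => x ^ m * |(f' x₁ + m / x₁ * f x₁) / x₁ ^ m|)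
        (𝓝[>] 0) (𝓝 0) := by
      have hcont : Continuous fun x : ℝ => x ^ m * |(f' x₁ + m / x₁ * f x₁) / x₁ ^ m| := by fun_prop
      have := hcont.tendsto 0
      rw [zero_pow (by omega), zero_mul] at this
      exact this.mono_left nhdsWithin_le_nhds
    filter_upwards [hlim.eventually_lt_const (half_pos hε), self_mem_nhdsWithin,
      nhdsWithin_le_nhds (Iio_mem_nhds hx₁)] with x hx hx0 hxx₁
    rw [mem_Ioi] at hx0
    rw [mem_Iio] at hxx₁
    have hpow : 0 < x ^ m := pow_pos hx0 m
    have hmv := norm_image_sub_le_of_norm_deriv_le_segment' (a := x) (b := x₁)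
      (C := ε / 2 / x ^ m)
      (fun t ht => (hp t ⟨hx0.trans_le ht.1, ht.2.trans_lt hδ₁⟩).hasDerivWithinAt)
      (fun t ht => by
        have ht0 : 0 < t := hx0.trans_le ht.1
        rw [norm_div, Real.norm_eq_abs, Real.norm_of_nonneg (pow_pos ht0 m).le]
        have h5 := (hfx₁ t ⟨ht0, ht.2.le⟩).2.2
        have h6 := ht.1
        gcongr) x₁ (right_mem_Icc.mpr hxx₁.le)
    have h7 : ε / 2 / x ^ m * (x₁ - x) ≤ ε / 2 / x ^ m :=
      mul_le_of_le_one_right (by positivity) (by linarith)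
    have h8 : |(f' x + m / x * f x) / x ^ m| ≤
        |(f' x₁ + m / x₁ * f x₁) / x₁ ^ m| + ε / 2 / x ^ m := by
      rw [Real.norm_eq_abs] at hmv
      have := abs_sub_abs_le_abs_sub ((f' x + m / x * f x) / x ^ m)
        ((f' x₁ + m / x₁ * f x₁) / x₁ ^ m)
      rw [abs_sub_comm] at this
      linarith
    rw [abs_div, abs_of_pos hpow, div_le_iff₀ hpow, add_mul, div_mul_cancel₀ _ hpow.ne'] at h8
    rw [Real.dist_eq, sub_zero]
    linarith
  have hfx : Tendsto (fun x => f x / x) (𝓝[>] 0) (𝓝 0) := by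
    rw [Metric.tendsto_nhds] at hp0 ⊢
    intro ε hε
    have h1 := hp0 (ε / 2) (half_pos hε)
    rw [eventually_nhdsWithin_iff, Metric.eventually_nhds_iff] at h1
    obtain ⟨r, hr, h1⟩ := h1
    filter_upwards [self_mem_nhdsWithin, nhdsWithin_le_nhds (Iio_mem_nhds (lt_min hδ hr))]
      with x hx0 hx
    rw [mem_Ioi] at hx0
    have hxδ : x < δ := lt_of_lt_of_le hx (min_le_left _ _)
    have hxr : x < r := lt_of_lt_of_le hx (min_le_right _ _)
    have hpow : 0 < x ^ m := pow_pos hx0 m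
    have h2 : ∀ y ∈ Ioo 0 x, |x ^ m * f x - y ^ m * f y| ≤ x ^ m * (ε / 2) * x := by
      intro y hy
      have hmv := norm_image_sub_le_of_norm_deriv_le_segment' (a := y) (b := x)
        (C := x ^ m * (ε / 2))
        (fun t ht => (hH t ⟨hy.1.trans_le ht.1, ht.2.trans_lt hxδ⟩).hasDerivWithinAt)
        (fun t ht => by
          have ht0 : 0 < t := hy.1.trans_le ht.1
          rw [norm_mul, Real.norm_of_nonneg (pow_pos ht0 m).le]
          have h5 := h1 (y := t) (by
            rw [Real.dist_eq, sub_zero, abs_of_pos ht0]; linarith [ht.2]) ht0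
          rw [Real.dist_eq, sub_zero] at h5
          have h6 := ht.2.le
          rw [Real.norm_eq_abs]
          gcongr) x (right_mem_Icc.mpr hy.2.le)
      refine hmv.trans ?_
      have := hy.1
      gcongr
      linarith
    have h3 : Tendsto (fun y => |x ^ m * f x - y ^ m * f y|) (𝓝[>] 0)
        (𝓝 |x ^ m * f x - 0 ^ m * 0|) := by
      have h4 : Tendsto (fun y : ℝ => y ^ m) (𝓝[>] 0) (𝓝 (0 ^ m)) :=
        ((continuous_pow m).tendsto 0).mono_left nhdsWithin_le_nhds
      exact (tendsto_const_nhds.sub (h4.mul h0)).abs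
    have h4 := le_of_tendsto h3 (by
      filter_upwards [Ioo_mem_nhdsGT hx0] with y hy using h2 y hy)
    rw [mul_zero, sub_zero, abs_mul, abs_of_pos hpow, mul_assoc] at h4
    have h5 := le_of_mul_le_mul_left h4 hpow
    rw [Real.dist_eq, sub_zero, abs_div, abs_of_pos hx0, div_lt_iff₀ hx0]
    nlinarith
  refine ⟨?_, hfx⟩
  have := hp0.sub (hfx.const_mul (m : ℝ))
  rw [mul_zero, sub_zero] at this
  refine this.congr fun x => ?_
  ring

/-- A monotone function on `(a, b)` that tends to `0` at both ends vanishes. -/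
lemma eq_zero_of_monotoneOn_of_tendsto {F : ℝ → ℝ} {a b : ℝ} (hF : MonotoneOn F (Ioo a b))
    (ha : Tendsto F (𝓝[>] a) (𝓝 0)) (hb : Tendsto F (𝓝[<] b) (𝓝 0)) {x : ℝ} (hx : x ∈ Ioo a b) :
    F x = 0 := by
  apply le_antisymm
  · refine ge_of_tendsto hb ?_
    filter_upwards [Ioo_mem_nhdsLT hx.2] with y hy
    exact hF hx ⟨hx.1.trans hy.1, hy.2⟩ hy.1.le
  · refine le_of_tendsto ha ?_
    filter_upwards [Ioo_mem_nhdsGT hx.1] with y hy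
    exact hF ⟨hy.1, hy.2.trans hx.2⟩ hx hy.2.le

/-! ### The pole lattice and quasi-periodic functions -/

lemma isOpen_compl_poleLattice (T : ℝ) (hT : 0 < T) : IsOpen (poleLattice T)ᶜ := by
  have h : poleLattice T = (fun x : ℝ => x / T) ⁻¹' range ((↑) : ℤ → ℝ) := by
    ext x
    constructor
    · rintro ⟨k, rfl⟩
      exact ⟨k, by field_simp⟩
    · rintro ⟨k, hk⟩
      refine ⟨k, ?_⟩
      simp only at hk ⊢
      rw [hk, div_mul_cancel₀ _ hT.ne']
  rw [h, isOpen_compl_iff]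
  exact Int.isClosedEmbedding_coe_real.isClosed_range.preimage (by fun_prop)

lemma zero_mem_poleLattice (T : ℝ) : (0 : ℝ) ∈ poleLattice T := ⟨0, by simp⟩

lemma add_int_mul_mem_poleLattice_iff {T x : ℝ} (k : ℤ) :
    x + k * T ∈ poleLattice T ↔ x ∈ poleLattice T := by
  constructor
  · rintro ⟨l, hl⟩
    exact ⟨l - k, by push_cast; simp only at hl; linarith⟩
  · rintro ⟨l, rfl⟩
    exact ⟨l + k, by push_cast; ring⟩

lemma add_mem_poleLattice_iff {T x : ℝ} : x + T ∈ poleLattice T ↔ x ∈ poleLattice T := by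
  simpa using add_int_mul_mem_poleLattice_iff (T := T) (x := x) 1

lemma Ioo_subset_compl_poleLattice {T : ℝ} (hT : 0 < T) (k : ℤ) :
    Ioo (k * T) ((k + 1) * T) ⊆ (poleLattice T)ᶜ := by
  rintro x ⟨h1, h2⟩ ⟨l, rfl⟩
  simp only at h1 h2
  have h3 : (k : ℝ) < l := lt_of_mul_lt_mul_right h1 hT.le
  have h4 : (l : ℝ) < k + 1 := lt_of_mul_lt_mul_right h2 hT.le
  have h3' : k < l := by exact_mod_cast h3
  have h4' : l < k + 1 := by exact_mod_cast h4
  omega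

lemma Ioo_zero_subset_compl_poleLattice {T : ℝ} (hT : 0 < T) : Ioo 0 T ⊆ (poleLattice T)ᶜ := by
  simpa using Ioo_subset_compl_poleLattice hT 0

lemma exists_mem_Ioo_of_notMem_poleLattice {T : ℝ} (hT : 0 < T) {x : ℝ} (hx : x ∉ poleLattice T) :
    ∃ k : ℤ, x ∈ Ioo (k * T) ((k + 1) * T) := by
  refine ⟨⌊x / T⌋, lt_of_le_of_ne ?_ ?_, ?_⟩
  · exact (le_div_iff₀ hT).mp (Int.floor_le _)
  · exact fun h => hx ⟨_, h⟩
  · exact (div_lt_iff₀ hT).mp (Int.lt_floor_add_one _)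

lemma eventually_notMem_poleLattice {T : ℝ} (hT : 0 < T) (k : ℤ) :
    ∀ᶠ x in 𝓝[≠] (k * T), x ∉ poleLattice T := by
  have h1 : Ioo ((k - 1) * T) ((k + 1) * T) ∈ 𝓝 (k * T) :=
    Ioo_mem_nhds (by nlinarith) (by nlinarith)
  filter_upwards [nhdsWithin_le_nhds h1, self_mem_nhdsWithin] with x hx hne
  rcases lt_or_gt_of_ne hne with h | h
  · have := Ioo_subset_compl_poleLattice hT (k - 1)
    push_cast at this
    exact this ⟨hx.1, by simpa using h⟩
  · exact Ioo_subset_compl_poleLattice hT k ⟨h, hx.2⟩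

lemma quasiPeriodic_int {f : ℝ → ℝ} {T ρ : ℝ} (hf : ∀ x, f (x + T) = ρ * f x) (hρ : ρ ≠ 0)
    (k : ℤ) (x : ℝ) : f (x + k * T) = ρ ^ k * f x := by
  induction k using Int.induction_on generalizing x with
  | zero => simp
  | succ n ih =>
    have h1 := hf (x + n * T)
    push_cast at ih ⊢
    rw [add_mul, one_mul, ← add_assoc, h1, ih, zpow_add_one₀ hρ]
    ring
  | pred n ih =>
    have h1 := hf (x + (-n - 1) * T)
    have h2 : x + (-n - 1) * T + T = x + (-n : ℝ) * T := by ring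
    push_cast at ih ⊢
    rw [h2, ih] at h1
    rw [zpow_sub_one₀ hρ]
    field_simp
    linarith

/-! ### Eigenfunctions that extend to the whole line -/

/-- A solution on the line, smooth across the poles, that is multiplied by `ρ` under `x ↦ x + T`
and vanishes at `0` (and so on the whole lattice) exactly to the order `m + 1`, as solutions for a
potential with the singularity `m (m + 1) / x²` do. -/
structure IsBlochEigenfunction (T : ℝ) (U : ℝ → ℝ) (m : ℕ) (E ρ : ℝ) (f : ℝ → ℝ) : Prop where
  contDiff : ContDiff ℝ ∞ f
  ne_zero : ρ ≠ 0
  quasiPeriodic : ∀ x, f (x + T) = ρ * f x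
  solves : SolvesSchrodingerOn (poleLattice T)ᶜ U E f
  order : ∃ k : ℝ → ℝ, ContDiff ℝ ∞ k ∧ k 0 ≠ 0 ∧ ∀ x, f x = x ^ (m + 1) * k x

namespace IsBlochEigenfunction

variable {T : ℝ} {U : ℝ → ℝ} {m : ℕ} {E ρ : ℝ} {f : ℝ → ℝ}

lemma eq_zero_of_mem (h : IsBlochEigenfunction T U m E ρ f) {x : ℝ} (hx : x ∈ poleLattice T) :
    f x = 0 := by
  obtain ⟨k, rfl⟩ := hx
  obtain ⟨K, -, -, hK⟩ := h.order
  have := quasiPeriodic_int h.quasiPeriodic h.ne_zero k 0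
  rw [zero_add, hK 0] at this
  simp only
  rw [this]
  simp

lemma eventually_ne_zero (h : IsBlochEigenfunction T U m E ρ f) : ∀ᶠ x in 𝓝[≠] 0, f x ≠ 0 := by
  obtain ⟨K, hK, hK0, hfK⟩ := h.order
  filter_upwards [self_mem_nhdsWithin,
    nhdsWithin_le_nhds (hK.continuous.continuousAt.eventually_ne hK0)] with x hx hKx
  rw [hfK]
  exact mul_ne_zero (pow_ne_zero _ hx) hKx

lemma exists_ne_zero (h : IsBlochEigenfunction T U m E ρ f) (hT : 0 < T) :
    ∃ x ∈ Ioo 0 T, f x ≠ 0 := by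
  have h1 : ∀ᶠ x in 𝓝[>] (0 : ℝ), f x ≠ 0 :=
    h.eventually_ne_zero.filter_mono (nhdsWithin_mono _ fun x hx => ne_of_gt hx)
  obtain ⟨x, hx, hxT⟩ := (h1.and (Ioo_mem_nhdsGT hT)).exists
  exact ⟨x, hxT, hx⟩

/-- At each point of the lattice the eigenfunction has a zero of finite order. -/
lemma order_at (h : IsBlochEigenfunction T U m E ρ f) (j : ℤ) :
    ∃ k : ℝ → ℝ, ContDiff ℝ ∞ k ∧ k (j * T) ≠ 0 ∧ ∀ x, f x = (x - j * T) ^ (m + 1) * k x := by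
  obtain ⟨K, hK, hK0, hfK⟩ := h.order
  refine ⟨fun x => ρ ^ j * K (x - j * T), ?_, ?_, fun x => ?_⟩
  · exact contDiff_const.mul (hK.comp (contDiff_id.sub contDiff_const))
  · simp only [sub_self]
    exact mul_ne_zero (zpow_ne_zero _ h.ne_zero) hK0
  · have := quasiPeriodic_int h.quasiPeriodic h.ne_zero j (x - j * T)
    rw [sub_add_cancel, hfK (x - j * T)] at this
    rw [this]
    ring

lemma tendsto_nhds (h : IsBlochEigenfunction T U m E ρ f) {a : ℝ} (ha : a ∈ poleLattice T) :
    Tendsto f (𝓝 a) (𝓝 0) := by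
  have := h.contDiff.continuous.tendsto a
  rwa [h.eq_zero_of_mem ha] at this

lemma mem_hermitSpectrum (h : IsBlochEigenfunction T U m E ρ f) (hT : 0 < T) :
    E ∈ hermitSpectrum T U :=
  ⟨f, h.solves.mono (Ioo_zero_subset_compl_poleLattice hT),
    (h.tendsto_nhds (zero_mem_poleLattice T)).mono_left nhdsWithin_le_nhds,
    (h.tendsto_nhds ⟨1, by simp⟩).mono_left nhdsWithin_le_nhds, h.exists_ne_zero hT⟩

end IsBlochEigenfunction

/-- A smooth real quasi-periodic solution gives a real point of the Bloch curve. -/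
lemma mem_blochCurve_of_real {T : ℝ} (hT : 0 < T) {U : ℝ → ℝ}
    (hU : ContinuousOn U (poleLattice T)ᶜ) {E κ : ℝ} {f : ℝ → ℝ} (hf : ContDiff ℝ ∞ f)
    (hs : SolvesSchrodingerOn (poleLattice T)ᶜ U E f) (hκ : ∀ x, f (x + T) = κ * f x)
    (hne : ∃ x ∉ poleLattice T, f x ≠ 0) : ((E : ℂ), (κ : ℂ)) ∈ blochCurve T U := by
  obtain ⟨x₀, hx₀, hfx₀⟩ := hne
  refine ⟨fun x => (f x : ℂ), hs.ofReal (isOpen_compl_poleLattice T hT) hU, fun a _ => ?_,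
    fun x _ => ?_, x₀, hx₀, Complex.ofReal_ne_zero.mpr hfx₀⟩
  · refine ⟨0, fun x => (f x : ℂ), ?_, Eventually.of_forall fun x => by simp⟩
    exact (Complex.ofRealCLM.contDiff.comp hf).contDiffAt
  · simp [hκ]

/-! ### The state of the chain after `m` Crum transformations -/

/-- The properties that are carried along the chain of Crum transformations: `U` is periodic and
smooth up to poles of the form `m (m + 1) / x²` on the lattice, its spectrum is `μ m < μ (m+1) < ⋯`,
its Bloch curve is `B`, and the eigenfunctions extend to the line, the `n`-th one with at most `n`
zeros in `(0, T)`. The inverse of its multiplier also belongs to `B`. -/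
structure IsCrumState (T : ℝ) (B : Set (ℂ × ℂ)) (μ : ℕ → ℝ) (m : ℕ) (U : ℝ → ℝ) : Prop where
  periodic : Function.Periodic U T
  contDiffOn : ContDiffOn ℝ ∞ U (poleLattice T)ᶜ
  pole : ∃ h : ℝ → ℝ, ContDiffAt ℝ ∞ h 0 ∧
    ∀ᶠ x in 𝓝[≠] 0, U x = (m : ℝ) * ((m : ℝ) + 1) / x ^ 2 + h x
  spectrum : hermitSpectrum T U = range fun n : ℕ => μ (n + m)
  bloch : blochCurve T U = B
  eigenfunction : ∀ n, ∃ (f : ℝ → ℝ) (ρ : ℝ), IsBlochEigenfunction T U m (μ (n + m)) ρ f ∧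
    {x ∈ Ioo 0 T | f x = 0}.Finite ∧ {x ∈ Ioo 0 T | f x = 0}.ncard ≤ n ∧
    ((μ (n + m) : ℂ), ((ρ⁻¹ : ℝ) : ℂ)) ∈ B

/-! ### The smooth potential -/

open scoped NNReal in
lemma solution_eq_of_initial_values {U : ℝ → ℝ} {M : ℝ≥0} (hM : ∀ x, |U x| ≤ M) {E x₀ : ℝ}
    {u u' w w' : ℝ → ℝ} (hu : ∀ x, HasDerivAt u (u' x) x)
    (hu' : ∀ x, HasDerivAt u' ((U x - E) * u x) x) (hw : ∀ x, HasDerivAt w (w' x) x)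
    (hw' : ∀ x, HasDerivAt w' ((U x - E) * w x) x) (h0 : u x₀ = w x₀) (h0' : u' x₀ = w' x₀)
    (x : ℝ) : u x = w x := by
  refine (solution_eqOn_of_initial_values hM (a := min x x₀ - 1) (b := max x x₀ + 1) (x₀ := x₀) ?_
    (fun x _ => hu x) (fun x _ => hu' x) (fun x _ => hw x) (fun x _ => hw' x) h0 h0').1 ?_
  · constructor <;> linarith [min_le_right x x₀, le_max_right x x₀]
  · constructor <;> linarith [min_le_left x x₀, le_max_left x x₀]

lemma contDiff_of_solution {U : ℝ → ℝ} (hU : ContDiff ℝ ∞ U) {E : ℝ} {u u' : ℝ → ℝ}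
    (hu : ∀ x, HasDerivAt u (u' x) x) (hu' : ∀ x, HasDerivAt u' ((U x - E) * u x) x) :
    ContDiff ℝ ∞ u ∧ ContDiff ℝ ∞ u' := by
  have key : ∀ n : ℕ, ContDiff ℝ n u ∧ ContDiff ℝ n u' := by
    intro n
    induction n with
    | zero =>
      simp only [Nat.cast_zero, contDiff_zero]
      exact ⟨continuous_iff_continuousAt.mpr fun x => (hu x).continuousAt,
        continuous_iff_continuousAt.mpr fun x => (hu' x).continuousAt⟩
    | succ n ih =>
      have hUn : ContDiff ℝ n U := hU.of_le (by exact_mod_cast le_top)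
      simp only [Nat.cast_add, Nat.cast_one, contDiff_succ_iff_deriv]
      refine ⟨⟨fun x => (hu x).differentiableAt, by simp, ?_⟩,
        ⟨fun x => (hu' x).differentiableAt, by simp, ?_⟩⟩
      · rw [show deriv u = u' from funext fun x => (hu x).deriv]
        exact ih.2
      · rw [show deriv u' = _ from funext fun x => (hu' x).deriv]
        exact (hUn.sub contDiff_const).mul ih.1
  exact ⟨contDiff_infty.mpr fun n => (key n).1, contDiff_infty.mpr fun n => (key n).2⟩

open scoped NNReal in
/-- The initial state of the chain: Sturm–Liouville theory of a smooth periodic potential. -/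
theorem exists_isCrumState_zero {T : ℝ} (hT : 0 < T) {U : ℝ → ℝ} (hU : ContDiff ℝ ∞ U)
    (hper : Function.Periodic U T) : ∃ μ : ℕ → ℝ, StrictMono μ ∧
      IsCrumState T (blochCurve T U) μ 0 U := by
  have hUc := hU.continuous
  obtain ⟨M, hM⟩ : ∃ M : ℝ≥0, ∀ x, |U x| ≤ M := by
    obtain ⟨C, hC⟩ := (isCompact_Icc (a := 0) (b := T)).exists_bound_of_continuousOn
      hUc.continuousOn
    refine ⟨⟨|C|, abs_nonneg C⟩, fun x => ?_⟩
    obtain ⟨y, hy, hxy⟩ := hper.exists_mem_Ico₀ hT x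
    rw [hxy]
    exact (hC y (Ico_subset_Icc_self hy)).trans (le_abs_self C)
  have hso := isOpen_compl_poleLattice T hT
  obtain ⟨μ, φ, φ', hμ, h0, hφ, hφ', hspec, hzeros⟩ := exists_dirichlet_eigenvalues hUc hM hT
  have hsolves : ∀ {E : ℝ} {u u' : ℝ → ℝ}, (∀ x, HasDerivAt u (u' x) x) →
      (∀ x, HasDerivAt u' ((U x - E) * u x) x) → SolvesSchrodingerOn (poleLattice T)ᶜ U E u := by
    intro E u u' hu hu'
    refine .of_hasDerivAt hso hUc.continuousOn (fun x _ => hu x) fun x _ => ?_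
    refine (hu' x).congr_deriv ?_
    rw [smul_eq_mul, sub_mul]
  have hshift : ∀ {E : ℝ} {u u' : ℝ → ℝ}, (∀ x, HasDerivAt u (u' x) x) →
      (∀ x, HasDerivAt u' ((U x - E) * u x) x) →
      (∀ x, HasDerivAt (fun x => u (x + T)) (u' (x + T)) x) ∧
      ∀ x, HasDerivAt (fun x => u' (x + T)) ((U x - E) * u (x + T)) x := by
    intro E u u' hu hu'
    refine ⟨fun x => (hu (x + T)).comp_add_const x T, fun x => ?_⟩
    have := (hu' (x + T)).comp_add_const x T
    rwa [hper x] at this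
  have heig : ∀ n, IsBlochEigenfunction T U 0 (μ n) (φ' (μ n) T) (φ (μ n)) := by
    intro n
    have hφT : φ (μ n) T = 0 := (hspec _).mpr ⟨n, rfl⟩
    have hquasi : ∀ x, φ (μ n) (x + T) = φ' (μ n) T * φ (μ n) x := by
      have h1 := hshift (hφ (μ n)) (hφ' (μ n))
      refine solution_eq_of_initial_values hM (x₀ := 0) h1.1 h1.2
        (fun x => (hφ (μ n) x).const_mul (φ' (μ n) T))
        (fun x => ((hφ' (μ n) x).const_mul (φ' (μ n) T)).congr_deriv (by ring)) ?_ ?_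
      · simp [hφT, (h0 (μ n)).1]
      · simp [(h0 (μ n)).2]
    refine ⟨(contDiff_of_solution hU (hφ _) (hφ' _)).1, ?_, hquasi, hsolves (hφ _) (hφ' _), ?_⟩
    · intro hz
      have h2 : ∀ x, φ (μ n) x = 0 := fun x => by
        have := hquasi (x - T)
        rwa [sub_add_cancel, hz, zero_mul] at this
      have h3 := (hφ (μ n) 0).unique ((hasDerivAt_const (0 : ℝ) (0 : ℝ)).congr_of_eventuallyEq
        (Eventually.of_forall h2))
      rw [(h0 _).2] at h3
      exact one_ne_zero h3
    · obtain ⟨K, hK, hK0, hKx⟩ := exists_contDiff_eq_pow_mul (m := 0)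
        (contDiff_of_solution hU (hφ (μ n)) (hφ' (μ n))).2
        (fun x => by simpa using hφ (μ n) x) (h0 (μ n)).1
      exact ⟨K, hK, by rw [hK0, (h0 _).2]; simp, hKx⟩
  refine ⟨μ, hμ, hper, hU.contDiffOn, ⟨U, hU.contDiffAt, by simp⟩, ?_, rfl, fun n => ?_⟩
  · ext E
    simp only [add_zero]
    constructor
    · rintro ⟨f, hf, hf0, hfT, x₁, hx₁, hfx₁⟩
      have hmid : T / 2 ∈ Ioo 0 T := ⟨by linarith, by linarith⟩
      obtain ⟨w, w', hw0, hw0', hw, hw'⟩ :=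
        exists_solution_of_initial_values hUc hM E (T / 2) (f (T / 2)) (deriv f (T / 2))
      have heq : EqOn f w (Ioo 0 T) := (solution_eqOn_of_initial_values hM hmid
        (fun x hx => hf.hasDerivAt isOpen_Ioo hx)
        (fun x hx => (hf.hasDerivAt_deriv isOpen_Ioo hx).congr_deriv (by
          rw [smul_eq_mul, sub_mul]))
        (fun x _ => hw x) (fun x _ => hw' x) hw0.symm hw0'.symm).1
      have hwa : w 0 = 0 := by
        refine tendsto_nhds_unique ((hw 0).continuousAt.tendsto.mono_left nhdsWithin_le_nhds)
          (hf0.congr' ?_)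
        filter_upwards [Ioo_mem_nhdsGT hT] with x hx using heq hx
      have hwb : w T = 0 := by
        refine tendsto_nhds_unique ((hw T).continuousAt.tendsto.mono_left nhdsWithin_le_nhds)
          (hfT.congr' ?_)
        filter_upwards [Ioo_mem_nhdsLT hT] with x hx using heq hx
      have hwφ := solution_eq_of_initial_values hM (x₀ := 0) hw hw'
        (fun x => (hφ E x).const_mul (w' 0))
        (fun x => ((hφ' E x).const_mul (w' 0)).congr_deriv (by ring))
        (by simp [hwa, (h0 E).1]) (by simp [(h0 E).2])
      rw [heq hx₁, hwφ] at hfx₁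
      have h4 := hwφ T
      rw [hwb] at h4
      exact (hspec E).mp ((mul_eq_zero.mp h4.symm).resolve_left (left_ne_zero_of_mul hfx₁))
    · rintro ⟨n, rfl⟩
      exact (heig n).mem_hermitSpectrum hT
  · refine ⟨φ (μ n), φ' (μ n) T, heig n, (hzeros n).1, (hzeros n).2, ?_⟩
    simp only [add_zero]
    have hquasi := (heig n).quasiPeriodic
    have hρ := (heig n).ne_zero
    have hφT : φ (μ n) T = 0 := (heig n).eq_zero_of_mem ⟨1, by simp⟩
    set ρ := φ' (μ n) T with hρdef
    by_cases hρ1 : ρ = ρ⁻¹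
    · rw [← hρ1]
      obtain ⟨x, hx, hx0⟩ := (heig n).exists_ne_zero hT
      exact mem_blochCurve_of_real hT hUc.continuousOn (heig n).contDiff (heig n).solves hquasi
        ⟨x, Ioo_zero_subset_compl_poleLattice hT hx, hx0⟩
    · -- The other eigenvector of the monodromy, whose determinant is `1`.
      obtain ⟨c, c', hc0, hc0', hc, hc'⟩ :=
        exists_solution_of_initial_values hUc hM (μ n) 0 1 0
      have hW : ∀ x, c x * φ' (μ n) x - c' x * φ (μ n) x = 1 := by
        have hd : ∀ x, HasDerivAt (fun x => c x * φ' (μ n) x - c' x * φ (μ n) x) 0 x := fun x =>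
          (((hc x).mul (hφ' (μ n) x)).sub ((hc' x).mul (hφ (μ n) x))).congr_deriv (by ring)
        intro x
        have := is_const_of_deriv_eq_zero (fun x => (hd x).differentiableAt)
          (fun x => (hd x).deriv) x 0
        simpa [hc0, hc0', (h0 (μ n)).2] using this
      have hcT : c T = ρ⁻¹ := by
        have := hW T
        rw [hφT, mul_zero, sub_zero] at this
        exact eq_inv_of_mul_eq_one_left this
      have hsh := hshift hc hc'
      have hcq : ∀ x, c (x + T) = ρ⁻¹ * c x + c' T * φ (μ n) x := by
        refine solution_eq_of_initial_values hM (x₀ := 0) hsh.1 hsh.2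
          (fun x => ((hc x).const_mul _).add ((hφ (μ n) x).const_mul _))
          (fun x => (((hc' x).const_mul _).add ((hφ' (μ n) x).const_mul _)).congr_deriv
            (by ring)) ?_ ?_
        · simp [hc0, hcT, (h0 (μ n)).1]
        · simp [hc0', (h0 (μ n)).2]
      -- `c + a φ` has the multiplier `ρ⁻¹` exactly for `a (ρ - ρ⁻¹) = -c' T`.
      set a := -c' T / (ρ - ρ⁻¹) with ha
      have ha' : a * (ρ - ρ⁻¹) = -c' T := div_mul_cancel₀ _ (sub_ne_zero.mpr hρ1)
      have hψ : ∀ x, HasDerivAt (fun x => c x + a * φ (μ n) x) (c' x + a * φ' (μ n) x) x :=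
        fun x => (hc x).add ((hφ (μ n) x).const_mul _)
      have hψ' : ∀ x, HasDerivAt (fun x => c' x + a * φ' (μ n) x)
          ((U x - μ n) * (c x + a * φ (μ n) x)) x :=
        fun x => ((hc' x).add ((hφ' (μ n) x).const_mul _)).congr_deriv (by ring)
      refine mem_blochCurve_of_real hT hUc.continuousOn (contDiff_of_solution hU hψ hψ').1
        (hsolves hψ hψ') (fun x => ?_) ?_
      · rw [hcq, hquasi]
        linear_combination φ (μ n) x * ha'
      · have h5 : ∀ᶠ x in 𝓝[≠] (0 : ℝ), c x + a * φ (μ n) x ≠ 0 :=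
          nhdsWithin_le_nhds ((hψ 0).continuousAt.eventually_ne (by simp [hc0, (h0 (μ n)).1]))
        have h6 := eventually_notMem_poleLattice hT 0
        simp only [Int.cast_zero, zero_mul] at h6
        obtain ⟨x, hx, hx'⟩ := (h6.and h5).exists
        exact ⟨x, hx, hx'⟩

/-! ### The Crum transform -/

lemma SolvesSchrodingerOn.congr {𝕜 : Type} [RCLike 𝕜] {s : Set ℝ} {U : ℝ → ℝ} {E : 𝕜}
    {ψ φ : ℝ → 𝕜} (h : SolvesSchrodingerOn s U E ψ) (hs : IsOpen s) (hφ : EqOn φ ψ s) :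
    SolvesSchrodingerOn s U E φ := by
  have hev : ∀ {x}, x ∈ s → φ =ᶠ[𝓝 x] ψ := fun hx => by
    filter_upwards [hs.mem_nhds hx] with y hy using hφ hy
  refine ⟨h.1.congr hφ, fun x hx => ?_⟩
  rw [(hev hx).deriv.deriv_eq, hφ hx]
  exact h.2 x hx

lemma exists_eq_const_of_hasDerivAt_zero {E : Type*} [NormedAddCommGroup E] [NormedSpace ℝ E]
    {F : ℝ → E} {a b : ℝ} (hF : ∀ x ∈ Ioo a b, HasDerivAt F 0 x) :
    ∃ c, ∀ x ∈ Ioo a b, F x = c := by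
  rcases (Ioo a b).eq_empty_or_nonempty with h | ⟨x₀, hx₀⟩
  · exact ⟨0, by simp [h]⟩
  · refine ⟨F x₀, fun x hx => ?_⟩
    exact isOpen_Ioo.is_const_of_deriv_eq_zero isPreconnected_Ioo
      (fun y hy => (hF y hy).differentiableAt.differentiableWithinAt)
      (fun y hy => (hF y hy).deriv) hx hx₀

namespace IsBlochEigenfunction

variable {T : ℝ} {U : ℝ → ℝ} {m : ℕ} {E₀ ρ : ℝ} {η : ℝ → ℝ}

lemma hasDerivAt (h : IsBlochEigenfunction T U m E₀ ρ η) (x : ℝ) : HasDerivAt η (deriv η x) x :=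
  (h.contDiff.differentiable (by simp) x).hasDerivAt

lemma contDiff_deriv (h : IsBlochEigenfunction T U m E₀ ρ η) : ContDiff ℝ ∞ (deriv η) :=
  (contDiff_infty_iff_deriv.mp h.contDiff).2

lemma deriv_quasiPeriodic (h : IsBlochEigenfunction T U m E₀ ρ η) (x : ℝ) :
    deriv η (x + T) = ρ * deriv η x := by
  have h1 : HasDerivAt (fun x => η (x + T)) (deriv η (x + T)) x :=
    (h.hasDerivAt (x + T)).comp_add_const x T
  rw [funext h.quasiPeriodic] at h1
  exact h1.unique ((h.hasDerivAt x).const_mul ρ)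

/-- A ground state without zeros inside the first period has none outside the lattice. -/
lemma ne_zero_of_notMem (h : IsBlochEigenfunction T U m E₀ ρ η) (hT : 0 < T)
    (hη : ∀ x ∈ Ioo 0 T, η x ≠ 0) {x : ℝ} (hx : x ∉ poleLattice T) : η x ≠ 0 := by
  obtain ⟨k, hk⟩ := exists_mem_Ioo_of_notMem_poleLattice hT hx
  have h1 := quasiPeriodic_int h.quasiPeriodic h.ne_zero k (x - k * T)
  rw [sub_add_cancel] at h1
  rw [h1]
  exact mul_ne_zero (zpow_ne_zero _ h.ne_zero) (hη _ ⟨by linarith [hk.1], by linarith [hk.2]⟩)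

lemma isDarbouxPair (h : IsBlochEigenfunction T U m E₀ ρ η) (hT : 0 < T)
    (hη : ∀ x ∈ Ioo 0 T, η x ≠ 0) :
    IsDarbouxPair (poleLattice T)ᶜ U (darbouxTransform U η) E₀ (logDeriv η)
      (deriv (logDeriv η)) := by
  have hs := isOpen_compl_poleLattice T hT
  have hd : ∀ x ∈ (poleLattice T)ᶜ, HasDerivAt (logDeriv η) (U x - E₀ - logDeriv η x ^ 2) x := by
    intro x hx
    have hηx := h.ne_zero_of_notMem hT hη hx
    have h1 := (h.solves.hasDerivAt_deriv hs hx).div (h.hasDerivAt x) hηx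
    refine h1.congr_deriv ?_
    simp only [logDeriv_apply, smul_eq_mul]
    field_simp
  refine ⟨fun x hx => (hd x hx).differentiableAt.hasDerivAt, fun x hx => (hd x hx).deriv,
    fun x _ => rfl⟩

lemma logDeriv_periodic (h : IsBlochEigenfunction T U m E₀ ρ η) :
    Function.Periodic (logDeriv η) T := fun x => by
  rw [logDeriv_apply, logDeriv_apply, h.quasiPeriodic, h.deriv_quasiPeriodic,
    mul_div_mul_left _ _ h.ne_zero]

lemma darbouxTransform_periodic (h : IsBlochEigenfunction T U m E₀ ρ η)
    (hU : Function.Periodic U T) : Function.Periodic (darbouxTransform U η) T := fun x => by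
  have h1 : deriv (logDeriv η) (x + T) = deriv (logDeriv η) x := by
    rw [← deriv_comp_add_const, funext h.logDeriv_periodic]
  simp only [darbouxTransform, hU x, h1]

lemma contDiffOn_logDeriv (h : IsBlochEigenfunction T U m E₀ ρ η) (hT : 0 < T)
    (hη : ∀ x ∈ Ioo 0 T, η x ≠ 0) : ContDiffOn ℝ ∞ (logDeriv η) (poleLattice T)ᶜ :=
  h.contDiff_deriv.contDiffOn.div h.contDiff.contDiffOn fun _ hx => h.ne_zero_of_notMem hT hη hx

lemma contDiffOn_darbouxTransform (h : IsBlochEigenfunction T U m E₀ ρ η) (hT : 0 < T)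
    (hη : ∀ x ∈ Ioo 0 T, η x ≠ 0) (hU : ContDiffOn ℝ ∞ U (poleLattice T)ᶜ) :
    ContDiffOn ℝ ∞ (darbouxTransform U η) (poleLattice T)ᶜ :=
  hU.sub (contDiffOn_const.mul ((h.contDiffOn_logDeriv hT hη).deriv_of_isOpen
    (isOpen_compl_poleLattice T hT) (by simp)))

/-- Near the lattice, `η'/η` is `(m + 1) / x` up to a smooth function. -/
lemma exists_logDeriv_eq (h : IsBlochEigenfunction T U m E₀ ρ η) :
    ∃ l : ℝ → ℝ, ContDiffAt ℝ ∞ l 0 ∧ ∀ᶠ x in 𝓝[≠] 0, logDeriv η x = (m + 1) / x + l x := by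
  obtain ⟨k, hk, hk0, hηk⟩ := h.order
  have hk' : ContDiff ℝ ∞ (deriv k) := (contDiff_infty_iff_deriv.mp hk).2
  refine ⟨logDeriv k, hk'.contDiffAt.div hk.contDiffAt hk0, ?_⟩
  filter_upwards [self_mem_nhdsWithin,
    nhdsWithin_le_nhds (hk.continuous.continuousAt.eventually_ne hk0)] with x hx hkx
  have hx0 : x ≠ 0 := hx
  have h1 : deriv η x = (m + 1) * x ^ m * k x + x ^ (m + 1) * deriv k x := by
    have h2 := (hasDerivAt_pow (m + 1) x).fun_mul (hk.differentiable (by simp) x).hasDerivAt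
    rw [← funext hηk] at h2
    rw [h2.deriv]
    push_cast
    simp
  rw [logDeriv_apply, logDeriv_apply, h1, hηk]
  field_simp
  ring

lemma exists_pole_darbouxTransform (h : IsBlochEigenfunction T U m E₀ ρ η)
    (hU : ∃ u : ℝ → ℝ, ContDiffAt ℝ ∞ u 0 ∧
      ∀ᶠ x in 𝓝[≠] 0, U x = (m : ℝ) * ((m : ℝ) + 1) / x ^ 2 + u x) :
    ∃ u : ℝ → ℝ, ContDiffAt ℝ ∞ u 0 ∧ ∀ᶠ x in 𝓝[≠] 0, darbouxTransform U η x =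
      ((m + 1 : ℕ) : ℝ) * (((m + 1 : ℕ) : ℝ) + 1) / x ^ 2 + u x := by
  obtain ⟨u, hu, hUu⟩ := hU
  obtain ⟨l, hl, hηl⟩ := h.exists_logDeriv_eq
  have hl' : ContDiffAt ℝ ∞ (deriv l) 0 := hl.derivWithin (by simp)
  have hld : ∀ᶠ x in 𝓝 (0 : ℝ), DifferentiableAt ℝ l x :=
    ((hl.of_le (by simp : (1 : ℕ∞ω) ≤ ∞)).eventually (by simp)).mono fun x hx =>
      hx.differentiableAt (by simp)
  refine ⟨fun x => u x - 2 * deriv l x, hu.sub (contDiffAt_const.mul hl'), ?_⟩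
  filter_upwards [hUu, eventually_eventually_nhdsWithin.mpr hηl, self_mem_nhdsWithin,
    nhdsWithin_le_nhds hld] with x h1 h2 hx h3
  have hx0 : x ≠ 0 := hx
  have h4 : logDeriv η =ᶠ[𝓝 x] fun x => (m + 1) / x + l x := by
    rwa [isOpen_compl_singleton.nhdsWithin_eq hx] at h2
  have h5 : HasDerivAt (fun x : ℝ => (m + 1) / x + l x) (-(m + 1) / x ^ 2 + deriv l x) x := by
    refine (((hasDerivAt_inv hx0).const_mul ((m : ℝ) + 1)).add h3.hasDerivAt).congr_deriv ?_
    ring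
  simp only [darbouxTransform]
  rw [h4.deriv_eq, h5.deriv, h1]
  push_cast
  field_simp
  ring

/-- The Wronskian of two eigenfunctions of `U`. -/
lemma hasDerivAt_wronskian {E σ : ℝ} {f : ℝ → ℝ} (hT : 0 < T)
    (h : IsBlochEigenfunction T U m E₀ ρ η) (hf : IsBlochEigenfunction T U m E σ f) (x : ℝ) :
    HasDerivAt (fun x => deriv f x * η x - f x * deriv η x) ((E₀ - E) * (f x * η x)) x := by
  have hs := isOpen_compl_poleLattice T hT
  have h2 : ∀ {E σ : ℝ} {f : ℝ → ℝ}, IsBlochEigenfunction T U m E σ f →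
      HasDerivAt (deriv f) (deriv (deriv f) x) x := fun hf =>
    (hf.contDiff_deriv.differentiable (by simp) x).hasDerivAt
  refine (((h2 hf).mul (h.hasDerivAt x)).sub ((hf.hasDerivAt x).mul (h2 h))).congr_deriv ?_
  by_cases hx : x ∈ poleLattice T
  · rw [h.eq_zero_of_mem hx, hf.eq_zero_of_mem hx]
    ring
  · rw [(h.solves.hasDerivAt_deriv hs hx).deriv, (hf.solves.hasDerivAt_deriv hs hx).deriv]
    simp only [smul_eq_mul]
    ring

/-- The Darboux transformation takes an eigenfunction for another energy to an eigenfunction of the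
transformed potential, with the same multiplier, one order of vanishing more and one zero less.
Written as `W / η` with the Wronskian `W`, whose derivative is `(E₀ - E) f η`, it takes the right
value `0` at the lattice by the convention `0 / 0 = 0`. -/
lemma transform {E σ : ℝ} {f : ℝ → ℝ} (hT : 0 < T) (h : IsBlochEigenfunction T U m E₀ ρ η)
    (hη : ∀ x ∈ Ioo 0 T, η x ≠ 0) (hU : ContDiffOn ℝ ∞ U (poleLattice T)ᶜ)
    (hf : IsBlochEigenfunction T U m E σ f) (hE : E ≠ E₀) {N : ℕ}
    (hfin : {x ∈ Ioo 0 T | f x = 0}.Finite) (hcard : {x ∈ Ioo 0 T | f x = 0}.ncard ≤ N + 1) :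
    ∃ g, IsBlochEigenfunction T (darbouxTransform U η) (m + 1) E σ g ∧
      {x ∈ Ioo 0 T | g x = 0}.Finite ∧ {x ∈ Ioo 0 T | g x = 0}.ncard ≤ N := by
  have hs := isOpen_compl_poleLattice T hT
  obtain ⟨k, hk, hk0, hηk⟩ := h.order
  obtain ⟨l, hl, hl0, hfl⟩ := hf.order
  set W : ℝ → ℝ := fun x => deriv f x * η x - f x * deriv η x with hW
  have hWd := h.hasDerivAt_wronskian hT hf
  have hWs : ContDiff ℝ ∞ W :=
    (hf.contDiff_deriv.mul h.contDiff).sub (hf.contDiff.mul h.contDiff_deriv)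
  have hWq : ∀ x, W (x + T) = σ * ρ * W x := fun x => by
    simp only [hW, h.quasiPeriodic, hf.quasiPeriodic, h.deriv_quasiPeriodic,
      hf.deriv_quasiPeriodic]
    ring
  have hWz : ∀ x ∈ poleLattice T, W x = 0 := fun x hx => by
    simp [hW, h.eq_zero_of_mem hx, hf.eq_zero_of_mem hx]
  obtain ⟨K, hK, hK0, hWK⟩ := exists_contDiff_eq_pow_mul (m := 2 * m + 2) (W := W)
    (G := fun x => (E₀ - E) * (l x * k x)) (contDiff_const.mul (hl.mul hk))
    (fun x => (hWd x).congr_deriv (by rw [hηk, hfl]; ring)) (hWz 0 (zero_mem_poleLattice T))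
  have hK0' : K 0 ≠ 0 := by
    rw [hK0]
    exact div_ne_zero (mul_ne_zero (sub_ne_zero.mpr hE.symm) (mul_ne_zero hl0 hk0)) (by positivity)
  have hgq : ∀ x, W (x + T) / η (x + T) = σ * (W x / η x) := fun x => by
    rw [hWq, h.quasiPeriodic, mul_comm σ ρ, mul_assoc, mul_div_mul_left _ _ h.ne_zero,
      mul_div_assoc]
  have hg0 : ∀ x, W x / η x = x ^ (m + 2) * (K x / k x) := by
    intro x
    rw [hWK, hηk]
    by_cases hx : x = 0
    · simp [hx]
    · rw [show 2 * m + 2 + 1 = (m + 1) + (m + 2) by ring, pow_add, mul_assoc,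
        mul_div_mul_left _ _ (pow_ne_zero _ hx), mul_div_assoc]
  have hKk : ContDiffAt ℝ ∞ (fun x => K x / k x) 0 := hK.contDiffAt.div hk.contDiffAt hk0
  have hgs0 : ContDiffAt ℝ ∞ (fun x => W x / η x) 0 := by
    rw [funext hg0]
    exact (contDiffAt_id.pow _).mul hKk
  have hgs : ContDiff ℝ ∞ (fun x => W x / η x) := by
    rw [contDiff_iff_contDiffAt]
    intro x
    by_cases hx : x ∈ poleLattice T
    · obtain ⟨j, rfl⟩ := hx
      have h1 : (fun x => W x / η x) = fun x => σ ^ j * (W (x - j * T) / η (x - j * T)) := by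
        ext x
        have := quasiPeriodic_int (f := fun x => W x / η x) hgq hf.ne_zero j (x - j * T)
        rwa [sub_add_cancel] at this
      rw [h1]
      refine contDiffAt_const.mul ?_
      refine ContDiffAt.comp (g := fun x => W x / η x) (f := fun x => x - j * T) (j * T) ?_
        (contDiffAt_id.sub contDiffAt_const)
      simpa using hgs0
    · exact hWs.contDiffAt.div h.contDiff.contDiffAt (h.ne_zero_of_notMem hT hη hx)
  have hD := h.isDarbouxPair hT hη
  have hVc := (h.contDiffOn_darbouxTransform hT hη hU).continuousOn
  refine ⟨fun x => W x / η x, ⟨hgs, hf.ne_zero, hgq, ?_, ?_⟩, ?_⟩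
  · refine (hD.solves_transform hs hVc hf.solves).congr hs fun x hx => ?_
    have hηx := h.ne_zero_of_notMem hT hη hx
    simp only [hW, logDeriv_apply, smul_eq_mul]
    field_simp
  · -- The quotient by `x ^ (m + 2)` is smooth at `0` and, trivially, everywhere else.
    refine ⟨fun x => if x = 0 then K 0 / k 0 else W x / η x / x ^ (m + 2), ?_, ?_, fun x => ?_⟩
    · rw [contDiff_iff_contDiffAt]
      intro x
      by_cases hx : x = 0
      · subst hx
        refine hKk.congr_of_eventuallyEq (Eventually.of_forall fun y => ?_)
        simp only
        split_ifs with hy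
        · rw [hy]
        · rw [hg0, mul_div_cancel_left₀ _ (pow_ne_zero _ hy)]
      · have h1 : ContDiffAt ℝ ∞ (fun x => W x / η x / x ^ (m + 2)) x :=
          hgs.contDiffAt.div (contDiffAt_id.pow _) (pow_ne_zero _ hx)
        refine h1.congr_of_eventuallyEq ?_
        filter_upwards [isOpen_compl_singleton.mem_nhds hx] with y hy
        rw [if_neg (show y ≠ 0 from hy)]
    · simpa using ⟨hK0', hk0⟩
    · simp only
      split_ifs with hx
      · rw [hx, hWz 0 (zero_mem_poleLattice T)]
        simp
      · rw [mul_div_cancel₀ _ (pow_ne_zero _ hx)]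
  · have hset : {x ∈ Ioo 0 T | deriv W x = 0} = {x ∈ Ioo 0 T | f x = 0} := by
      ext x
      simp only [mem_ofPred_eq, and_congr_right_iff]
      intro hx
      rw [(hWd x).deriv]
      simp [sub_ne_zero.mpr hE.symm, hη x hx]
    have hset' : {x ∈ Ioo 0 T | W x / η x = 0} = {x ∈ Ioo 0 T | W x = 0} := by
      ext x
      simp only [mem_ofPred_eq, and_congr_right_iff]
      intro hx
      simp [hη x hx]
    rw [← hset] at hfin hcard
    rw [hset']
    exact finite_zeros_of_finite_zeros_deriv hT hWs.continuous.continuousOn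
      (hWz 0 (zero_mem_poleLattice T)) (hWz T ⟨1, by simp⟩) hfin hcard

lemma isGroundState (h : IsBlochEigenfunction T U m E₀ ρ η) (hT : 0 < T)
    (hE : IsLeast (hermitSpectrum T U) E₀) : IsGroundState T U η :=
  ⟨h.contDiff, fun _ hx => h.eq_zero_of_mem hx, h.exists_ne_zero hT, E₀, hE, h.solves⟩

/-- The ground state is unique up to a factor: on each interval of the complement of the lattice
by the vanishing of the Wronskian, and with the same factor on all of them since it is smooth. -/
lemma darbouxTransform_eq_of_isGroundState (h : IsBlochEigenfunction T U m E₀ ρ η) (hT : 0 < T)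
    (hη : ∀ x ∈ Ioo 0 T, η x ≠ 0) (hE : IsLeast (hermitSpectrum T U) E₀) {η₁ : ℝ → ℝ}
    (h₁ : IsGroundState T U η₁) : darbouxTransform U η₁ = darbouxTransform U η := by
  have hs := isOpen_compl_poleLattice T hT
  obtain ⟨hsm, hz, ⟨x₀, hx₀, hne⟩, E, hE', hsol⟩ := h₁
  obtain rfl : E = E₀ := hE'.unique hE
  have hconst : ∀ j : ℤ, ∃ c, ∀ x ∈ Ioo (j * T) ((j + 1) * T), η₁ x = η x * c := by
    intro j
    have hsub := Ioo_subset_compl_poleLattice hT j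
    have hWc : Continuous fun x => deriv η₁ x * η x - η₁ x * deriv η x := by
      have h1 := (contDiff_infty_iff_deriv.mp hsm).2.continuous
      have h2 := h.contDiff_deriv.continuous
      have h3 := h.contDiff.continuous
      have h4 := hsm.continuous
      fun_prop
    have hWd : ∀ x ∈ Ioo (j * T) ((j + 1) * T),
        HasDerivAt (fun x => deriv η₁ x * η x - η₁ x * deriv η x) 0 x := fun x hx => by
      have h5 := hsub hx
      refine (((hsol.hasDerivAt_deriv hs h5).mul (h.solves.hasDerivAt hs h5)).sub
        ((hsol.hasDerivAt hs h5).mul (h.solves.hasDerivAt_deriv hs h5))).congr_deriv ?_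
      simp only [smul_eq_mul]
      ring
    obtain ⟨w, hw⟩ := exists_eq_const_of_hasDerivAt_zero hWd
    have hlt : (j : ℝ) * T < (j + 1) * T := by nlinarith
    have hw0 : w = 0 := by
      have h6 := (hWc.tendsto (j * T)).mono_left (nhdsWithin_le_nhds (s := Ioi (j * T)))
      simp only [hz _ ⟨j, rfl⟩, h.eq_zero_of_mem ⟨j, rfl⟩, mul_zero, zero_mul, sub_zero] at h6
      refine tendsto_nhds_unique (tendsto_const_nhds.congr' ?_) h6
      filter_upwards [Ioo_mem_nhdsGT hlt] with x hx using (hw x hx).symm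
    obtain ⟨c, hc⟩ := exists_eq_const_of_hasDerivAt_zero (F := fun x => η₁ x / η x)
      (fun x hx => by
        have h5 := hsub hx
        have h7 := h.ne_zero_of_notMem hT hη h5
        refine ((hsol.hasDerivAt hs h5).fun_div (h.solves.hasDerivAt hs h5) h7).congr_deriv ?_
        rw [hw x hx, hw0, zero_div])
    refine ⟨c, fun x hx => ?_⟩
    rw [← hc x hx, mul_div_cancel₀ _ (h.ne_zero_of_notMem hT hη (hsub hx))]
  choose c hc using hconst
  have hstep : ∀ j : ℤ, c j = c (j + 1) := by
    intro j
    obtain ⟨k, hk, hk0, hηk⟩ := h.order_at (j + 1)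
    push_cast at hk0 hηk
    have hlt : (j : ℝ) * T < (j + 1) * T := by nlinarith
    have hlt' : ((j : ℝ) + 1) * T < (j + 1 + 1) * T := by nlinarith
    refine eq_of_eventually_eq_smul (g := η₁) (F := η) (K := k) (a := (j + 1) * T) (N := m + 1)
      hsm.contDiffAt hk.contDiffAt hk0 (Eventually.of_forall hηk) ?_ ?_
    · filter_upwards [Ioo_mem_nhdsLT hlt] with x hx using hc j x hx
    · filter_upwards [Ioo_mem_nhdsGT hlt'] with x hx
      have := hc (j + 1) x
      push_cast at this
      exact this hx
  have hall : ∀ j : ℤ, c j = c 0 := by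
    intro j
    induction j using Int.induction_on with
    | zero => rfl
    | succ n ih => rw [← hstep, ih]
    | pred n ih => rw [hstep, sub_add_cancel, ih]
  have heq : η₁ = fun x => c 0 * η x := by
    ext x
    by_cases hx : x ∈ poleLattice T
    · rw [hz x hx, h.eq_zero_of_mem hx, mul_zero]
    · obtain ⟨j, hj⟩ := exists_mem_Ioo_of_notMem_poleLattice hT hx
      rw [hc j x hj, hall, mul_comm]
  have hc0 : c 0 ≠ 0 := fun h0 => hne (by rw [heq]; simp [h0])
  have hlog : logDeriv η₁ = logDeriv η := by
    ext x
    rw [heq, logDeriv_apply, logDeriv_apply, deriv_const_mul_field, mul_div_mul_left _ _ hc0]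
  unfold darbouxTransform
  rw [hlog]

end IsBlochEigenfunction

/-! ### The spectrum of the transform -/

/-- A solution for a potential with the singularity `m (m + 1) / x²`, `m ≥ 1`, that tends to `0` at
the singular point is `o(x)` there, and its derivative tends to `0`. -/
lemma SolvesSchrodingerOn.tendsto_deriv {T : ℝ} (hT : 0 < T) {V : ℝ → ℝ} {m : ℕ} (hm : 1 ≤ m)
    (hV : ∃ u : ℝ → ℝ, ContDiffAt ℝ ∞ u 0 ∧
      ∀ᶠ x in 𝓝[≠] 0, V x = (m : ℝ) * ((m : ℝ) + 1) / x ^ 2 + u x)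
    {E : ℝ} {f : ℝ → ℝ} (hf : SolvesSchrodingerOn (Ioo 0 T) V E f)
    (h0 : Tendsto f (𝓝[>] 0) (𝓝 0)) :
    Tendsto (deriv f) (𝓝[>] 0) (𝓝 0) ∧ Tendsto (fun x => f x / x) (𝓝[>] 0) (𝓝 0) := by
  obtain ⟨u, hu, hVu⟩ := hV
  have h1 : ∀ᶠ x in 𝓝[>] (0 : ℝ), V x = (m : ℝ) * ((m : ℝ) + 1) / x ^ 2 + u x ∧
      |u x - E| ≤ |u 0 - E| + 1 ∧ x < T := by
    have h2 : ∀ᶠ x in 𝓝 (0 : ℝ), |u x - E| < |u 0 - E| + 1 :=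
      (hu.continuousAt.sub continuousAt_const).abs.eventually_lt_const (lt_add_one _)
    filter_upwards [hVu.filter_mono (nhdsWithin_mono _ fun x (hx : 0 < x) => hx.ne'),
      nhdsWithin_le_nhds h2, nhdsWithin_le_nhds (Iio_mem_nhds hT)] with x h3 h4 h5
      using ⟨h3, h4.le, h5⟩
  rw [eventually_nhdsWithin_iff, Metric.eventually_nhds_iff] at h1
  obtain ⟨δ, hδ, h1⟩ := h1
  have h6 : ∀ x ∈ Ioo 0 δ, V x = (m : ℝ) * ((m : ℝ) + 1) / x ^ 2 + u x ∧
      |u x - E| ≤ |u 0 - E| + 1 ∧ x < T := fun x hx =>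
    h1 (by rw [Real.dist_eq, sub_zero, abs_of_pos hx.1]; exact hx.2) hx.1
  refine tendsto_deriv_of_tendsto_zero hm (c := fun x => u x - E) hδ
    (fun x hx => hf.hasDerivAt isOpen_Ioo ⟨hx.1, (h6 x hx).2.2⟩)
    (fun x hx => (hf.hasDerivAt_deriv isOpen_Ioo ⟨hx.1, (h6 x hx).2.2⟩).congr_deriv ?_)
    (fun x hx => (h6 x hx).2.1) h0
  rw [(h6 x hx).1, smul_eq_mul]
  ring

lemma tendsto_sub_nhdsGT (T : ℝ) : Tendsto (fun x => T - x) (𝓝[>] 0) (𝓝[<] T) := by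
  refine tendsto_nhdsWithin_iff.mpr ⟨?_, ?_⟩
  · have : Continuous fun x : ℝ => T - x := by fun_prop
    have := this.tendsto 0
    rw [sub_zero] at this
    exact this.mono_left nhdsWithin_le_nhds
  · filter_upwards [self_mem_nhdsWithin] with x hx
    exact sub_lt_self T hx

lemma tendsto_sub_nhdsLT (T : ℝ) : Tendsto (fun x => T - x) (𝓝[<] T) (𝓝[>] 0) := by
  refine tendsto_nhdsWithin_iff.mpr ⟨?_, ?_⟩
  · have : Continuous fun x : ℝ => T - x := by fun_prop
    have := this.tendsto T
    rw [sub_self] at this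
    exact this.mono_left nhdsWithin_le_nhds
  · filter_upwards [self_mem_nhdsWithin] with x hx
    exact sub_pos.mpr (mem_Iio.mp hx)

/-- The mirror image of `SolvesSchrodingerOn.tendsto_deriv` at the right end of the period. -/
lemma SolvesSchrodingerOn.tendsto_deriv_right {T : ℝ} (hT : 0 < T) {V : ℝ → ℝ}
    (hper : Function.Periodic V T) {m : ℕ} (hm : 1 ≤ m)
    (hV : ∃ u : ℝ → ℝ, ContDiffAt ℝ ∞ u 0 ∧
      ∀ᶠ x in 𝓝[≠] 0, V x = (m : ℝ) * ((m : ℝ) + 1) / x ^ 2 + u x)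
    {E : ℝ} {f : ℝ → ℝ} (hf : SolvesSchrodingerOn (Ioo 0 T) V E f)
    (hVc : ContinuousOn V (Ioo 0 T)) (h0 : Tendsto f (𝓝[<] T) (𝓝 0)) :
    Tendsto (deriv f) (𝓝[<] T) (𝓝 0) ∧ Tendsto (fun x => f x / (T - x)) (𝓝[<] T) (𝓝 0) := by
  have hmem : ∀ x ∈ Ioo 0 T, T - x ∈ Ioo 0 T := fun x hx =>
    ⟨by linarith [hx.2], by linarith [hx.1]⟩
  have hd : ∀ x ∈ Ioo 0 T, HasDerivAt (fun x => f (T - x)) (-deriv f (T - x)) x := fun x hx =>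
    (hf.hasDerivAt isOpen_Ioo (hmem x hx)).comp_const_sub T x
  have hf' : SolvesSchrodingerOn (Ioo 0 T) (fun x => V (T - x)) E fun x => f (T - x) := by
    refine .of_hasDerivAt isOpen_Ioo ?_ hd fun x hx => ?_
    · exact hVc.comp (by fun_prop) hmem
    · refine ((hf.hasDerivAt_deriv isOpen_Ioo (hmem x hx)).comp_const_sub
        T x).fun_neg.congr_deriv ?_
      ring
  obtain ⟨u, hu, hVu⟩ := hV
  have hneg : Tendsto (fun x : ℝ => -x) (𝓝[≠] 0) (𝓝[≠] 0) := by
    refine tendsto_nhdsWithin_iff.mpr ⟨?_, ?_⟩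
    · have := (continuous_neg (G := ℝ)).tendsto 0
      rw [neg_zero] at this
      exact this.mono_left nhdsWithin_le_nhds
    · filter_upwards [self_mem_nhdsWithin] with x hx
      exact neg_ne_zero.mpr hx
  have h1 := hf'.tendsto_deriv hT hm ⟨fun x => u (-x), ?_, ?_⟩ (h0.comp (tendsto_sub_nhdsGT T))
  · refine ⟨?_, ?_⟩
    · have h2 := (h1.1.comp (tendsto_sub_nhdsLT T)).neg
      rw [neg_zero] at h2
      refine h2.congr' ?_
      filter_upwards [Ioo_mem_nhdsLT hT] with x hx
      simp only [Function.comp]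
      rw [(hd _ (hmem x hx)).deriv, neg_neg, sub_sub_cancel]
    · refine (h1.2.comp (tendsto_sub_nhdsLT T)).congr fun x => ?_
      simp
  · exact ContDiffAt.comp (g := u) (f := fun x => -x) 0 (by simpa using hu) contDiffAt_id.neg
  · filter_upwards [hneg.eventually hVu] with x hx
    rw [← hper (-x), neg_add_eq_sub] at hx
    rw [hx, neg_sq]

namespace IsBlochEigenfunction

variable {T : ℝ} {U : ℝ → ℝ} {m : ℕ} {E₀ ρ : ℝ} {η : ℝ → ℝ}

/-- `(∂ + η'/η) f` tends to `0` at both ends if `f` is a Dirichlet eigenfunction of the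
transformed potential. -/
lemma tendsto_inverse_transform (h : IsBlochEigenfunction T U m E₀ ρ η) (hT : 0 < T)
    (hη : ∀ x ∈ Ioo 0 T, η x ≠ 0) (hU : ContDiffOn ℝ ∞ U (poleLattice T)ᶜ)
    (hper : Function.Periodic U T)
    (hpole : ∃ u : ℝ → ℝ, ContDiffAt ℝ ∞ u 0 ∧
      ∀ᶠ x in 𝓝[≠] 0, U x = (m : ℝ) * ((m : ℝ) + 1) / x ^ 2 + u x)
    {E : ℝ} {f : ℝ → ℝ} (hf : SolvesSchrodingerOn (Ioo 0 T) (darbouxTransform U η) E f)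
    (h0 : Tendsto f (𝓝[>] 0) (𝓝 0)) (hT0 : Tendsto f (𝓝[<] T) (𝓝 0)) :
    Tendsto (fun x => deriv f x + logDeriv η x * f x) (𝓝[>] 0) (𝓝 0) ∧
      Tendsto (fun x => deriv f x + logDeriv η x * f x) (𝓝[<] T) (𝓝 0) := by
  have hVp := h.exists_pole_darbouxTransform hpole
  have hVc := ((h.contDiffOn_darbouxTransform hT hη hU).continuousOn).mono
    (Ioo_zero_subset_compl_poleLattice hT)
  obtain ⟨l, hl, hηl⟩ := h.exists_logDeriv_eq
  have hlim : Tendsto (fun x => x * logDeriv η x) (𝓝[≠] 0) (𝓝 (m + 1)) := by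
    have h1 : Tendsto (fun x => ((m : ℝ) + 1) + x * l x) (𝓝[≠] 0) (𝓝 ((m + 1) + 0 * l 0)) :=
      (tendsto_const_nhds.add (tendsto_id.mul hl.continuousAt.tendsto)).mono_left nhdsWithin_le_nhds
    rw [zero_mul, add_zero] at h1
    refine h1.congr' ?_
    filter_upwards [hηl, self_mem_nhdsWithin] with x hx hx0
    have hx0' : x ≠ 0 := hx0
    rw [hx]
    field_simp
  constructor
  · obtain ⟨h1, h2⟩ := hf.tendsto_deriv hT (Nat.le_add_left 1 m) hVp h0
    have h3 := h1.add (h2.mul (hlim.mono_left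
      (nhdsWithin_mono _ fun x (hx : 0 < x) => hx.ne')))
    rw [zero_mul, add_zero] at h3
    refine h3.congr' ?_
    filter_upwards [self_mem_nhdsWithin] with x hx
    have hx0 : x ≠ 0 := ne_of_gt hx
    field_simp
  · obtain ⟨h1, h2⟩ := hf.tendsto_deriv_right hT (h.darbouxTransform_periodic hper)
      (Nat.le_add_left 1 m) hVp hVc hT0
    have hshift : Tendsto (fun x => x - T) (𝓝[<] T) (𝓝[≠] 0) := by
      refine tendsto_nhdsWithin_iff.mpr ⟨?_, ?_⟩
      · have : Continuous fun x : ℝ => x - T := by fun_prop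
        have := this.tendsto T
        rw [sub_self] at this
        exact this.mono_left nhdsWithin_le_nhds
      · filter_upwards [self_mem_nhdsWithin] with x hx
        exact sub_ne_zero.mpr (ne_of_lt hx)
    have h3 := h1.sub (h2.mul (hlim.comp hshift))
    rw [zero_mul, sub_zero] at h3
    refine h3.congr' ?_
    filter_upwards [self_mem_nhdsWithin] with x hx
    have hx0 : T - x ≠ 0 := sub_ne_zero.mpr (ne_of_gt hx)
    have h4 : logDeriv η (x - T) = logDeriv η x := by
      rw [← h.logDeriv_periodic (x - T), sub_add_cancel]
    simp only [Function.comp, h4]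
    field_simp
    ring

/-- A Dirichlet eigenfunction of the transformed potential cannot be taken to a multiple `c η` of
the ground state: `η f` would be monotone, having the derivative `c η²`, and vanish at both ends. -/
lemma eq_zero_of_inverse_transform_eq (h : IsBlochEigenfunction T U m E₀ ρ η)
    (hη : ∀ x ∈ Ioo 0 T, η x ≠ 0) {f : ℝ → ℝ}
    (hf : ∀ x ∈ Ioo 0 T, HasDerivAt f (deriv f x) x)
    (h0 : Tendsto f (𝓝[>] 0) (𝓝 0)) (hT0 : Tendsto f (𝓝[<] T) (𝓝 0)) {c : ℝ}
    (hc : ∀ x ∈ Ioo 0 T, deriv f x + logDeriv η x * f x = η x * c) :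
    ∀ x ∈ Ioo 0 T, f x = 0 := by
  have hd : ∀ x ∈ Ioo 0 T, HasDerivAt (fun x => η x * f x) (c * η x ^ 2) x := by
    intro x hx
    refine ((h.hasDerivAt x).fun_mul (hf x hx)).congr_deriv ?_
    have h1 := hc x hx
    have h2 : logDeriv η x * η x = deriv η x := by
      rw [logDeriv_apply, div_mul_cancel₀ _ (hη x hx)]
    linear_combination η x * h1 - f x * h2
  have hF0 : Tendsto (fun x => η x * f x) (𝓝[>] 0) (𝓝 0) := by
    have := ((h.tendsto_nhds (zero_mem_poleLattice T)).mono_left nhdsWithin_le_nhds).mul h0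
    rwa [mul_zero] at this
  have hFT : Tendsto (fun x => η x * f x) (𝓝[<] T) (𝓝 0) := by
    have := ((h.tendsto_nhds (a := T) ⟨1, by simp⟩).mono_left nhdsWithin_le_nhds).mul hT0
    rwa [mul_zero] at this
  have hcont : ContinuousOn (fun x => η x * f x) (Ioo 0 T) := fun x hx =>
    (hd x hx).continuousAt.continuousWithinAt
  have hz : ∀ x ∈ Ioo 0 T, η x * f x = 0 := by
    intro x hx
    rcases le_total 0 c with hc0 | hc0
    · have hm : MonotoneOn (fun x => η x * f x) (Ioo 0 T) := by
        refine monotoneOn_of_hasDerivWithinAt_nonneg (convex_Ioo 0 T) hcont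
          (f' := fun x => c * η x ^ 2) (fun y hy => ?_) fun y _ => mul_nonneg hc0 (sq_nonneg _)
        rw [interior_Ioo] at hy
        exact (hd y hy).hasDerivWithinAt
      exact eq_zero_of_monotoneOn_of_tendsto hm hF0 hFT hx
    · have hm : MonotoneOn (fun x => -(η x * f x)) (Ioo 0 T) := by
        refine monotoneOn_of_hasDerivWithinAt_nonneg (convex_Ioo 0 T) hcont.neg
          (f' := fun x => -(c * η x ^ 2)) (fun y hy => ?_) fun y _ =>
            neg_nonneg.mpr (mul_nonpos_of_nonpos_of_nonneg hc0 (sq_nonneg _))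
        rw [interior_Ioo] at hy
        exact (hd y hy).fun_neg.hasDerivWithinAt
      have := eq_zero_of_monotoneOn_of_tendsto hm (by simpa using hF0.neg)
        (by simpa using hFT.neg) hx
      exact neg_eq_zero.mp this
  exact fun x hx => (mul_eq_zero.mp (hz x hx)).resolve_left (hη x hx)

/-- The Dirichlet spectrum of the transform is contained in that of `U` without the energy of the
ground state. -/
lemma hermitSpectrum_darbouxTransform_subset (h : IsBlochEigenfunction T U m E₀ ρ η) (hT : 0 < T)
    (hη : ∀ x ∈ Ioo 0 T, η x ≠ 0) (hU : ContDiffOn ℝ ∞ U (poleLattice T)ᶜ)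
    (hper : Function.Periodic U T)
    (hpole : ∃ u : ℝ → ℝ, ContDiffAt ℝ ∞ u 0 ∧
      ∀ᶠ x in 𝓝[≠] 0, U x = (m : ℝ) * ((m : ℝ) + 1) / x ^ 2 + u x) :
    hermitSpectrum T (darbouxTransform U η) ⊆ hermitSpectrum T U \ {E₀} := by
  rintro E ⟨f, hf, h0, hT0, x₁, hx₁, hfx₁⟩
  have hsub := Ioo_zero_subset_compl_poleLattice hT
  have hD := ((h.isDarbouxPair hT hη).mono hsub).symm
  have hlim := h.tendsto_inverse_transform hT hη hU hper hpole hf h0 hT0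
  have hp := hD.solves_transform isOpen_Ioo (hU.continuousOn.mono hsub) hf
  have hpd := fun {x} => hD.hasDerivAt_transform isOpen_Ioo hf (x := x)
  simp only [smul_eq_mul, neg_mul, sub_neg_eq_add] at hp hpd
  have hne : ¬ ∃ c, ∀ x ∈ Ioo 0 T, deriv f x + logDeriv η x * f x = η x * c := by
    rintro ⟨c, hc⟩
    exact hfx₁ (h.eq_zero_of_inverse_transform_eq hη (fun x hx => hf.hasDerivAt isOpen_Ioo hx)
      h0 hT0 hc x₁ hx₁)
  refine ⟨⟨_, hp, hlim.1, hlim.2, ?_⟩, ?_⟩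
  · by_contra hcon
    push Not at hcon
    exact hne ⟨0, fun x hx => by rw [hcon x hx, mul_zero]⟩
  · rintro (rfl : E = E₀)
    refine hne ?_
    obtain ⟨c, hc⟩ := exists_eq_const_of_hasDerivAt_zero
      (F := fun x => (deriv f x + logDeriv η x * f x) / η x) (a := 0) (b := T) (fun x hx => by
        refine ((hpd hx).fun_div (h.hasDerivAt x) (hη x hx)).congr_deriv ?_
        have h2 : logDeriv η x * η x = deriv η x := by
          rw [logDeriv_apply, div_mul_cancel₀ _ (hη x hx)]
        rw [← h2]
        simp only [RCLike.ofReal_real_eq_id, id, sub_self, zero_mul]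
        ring)
    exact ⟨c, fun x hx => by rw [← hc x hx, mul_div_cancel₀ _ (hη x hx)]⟩

end IsBlochEigenfunction

/-! ### Functions with at most a pole -/

lemma HasAtMostPoleAt.of_eventuallyEq {ψ φ : ℝ → ℂ} {a : ℝ} (h : HasAtMostPoleAt ψ a)
    (hφ : φ =ᶠ[𝓝[≠] a] ψ) : HasAtMostPoleAt φ a := by
  obtain ⟨n, g, hg, hψ⟩ := h
  exact ⟨n, g, hg, by filter_upwards [hφ, hψ] with x h1 h2 using h1.trans h2⟩

lemma ContDiffAt.ofReal_comp {f : ℝ → ℝ} {a : ℝ} (hf : ContDiffAt ℝ ∞ f a) :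
    ContDiffAt ℝ ∞ (fun x => (f x : ℂ)) a :=
  Complex.ofRealCLM.contDiff.contDiffAt.comp a hf

lemma contDiffAt_ofReal_sub_pow (a : ℝ) (n : ℕ) :
    ContDiffAt ℝ ∞ (fun x : ℝ => ((x : ℂ) - a) ^ n) a := by
  have h1 : ContDiffAt ℝ ∞ (fun x : ℝ => x) a := contDiffAt_id
  exact (h1.ofReal_comp.sub contDiffAt_const).pow n

lemma eventually_ofReal_sub_ne_zero (a : ℝ) : ∀ᶠ x : ℝ in 𝓝[≠] a, (x : ℂ) - a ≠ 0 := by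
  filter_upwards [self_mem_nhdsWithin] with x hx
  rw [← Complex.ofReal_sub]
  exact Complex.ofReal_ne_zero.mpr (sub_ne_zero.mpr hx)

lemma HasAtMostPoleAt.add {ψ φ : ℝ → ℂ} {a : ℝ} (hψ : HasAtMostPoleAt ψ a)
    (hφ : HasAtMostPoleAt φ a) : HasAtMostPoleAt (fun x => ψ x + φ x) a := by
  obtain ⟨n, g, hg, hψ⟩ := hψ
  obtain ⟨k, l, hl, hφ⟩ := hφ
  refine ⟨n + k, fun x => g x * ((x : ℂ) - a) ^ k + l x * ((x : ℂ) - a) ^ n,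
    (hg.mul (contDiffAt_ofReal_sub_pow a k)).add (hl.mul (contDiffAt_ofReal_sub_pow a n)), ?_⟩
  filter_upwards [hψ, hφ, eventually_ofReal_sub_ne_zero a] with x h1 h2 h3
  rw [h1, h2, pow_add]
  field_simp

lemma HasAtMostPoleAt.mul {ψ φ : ℝ → ℂ} {a : ℝ} (hψ : HasAtMostPoleAt ψ a)
    (hφ : HasAtMostPoleAt φ a) : HasAtMostPoleAt (fun x => ψ x * φ x) a := by
  obtain ⟨n, g, hg, hψ⟩ := hψ
  obtain ⟨k, l, hl, hφ⟩ := hφ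
  refine ⟨n + k, fun x => g x * l x, hg.mul hl, ?_⟩
  filter_upwards [hψ, hφ] with x h1 h2
  rw [h1, h2, pow_add, div_mul_div_comm]

lemma HasAtMostPoleAt.deriv {ψ : ℝ → ℂ} {a : ℝ} (hψ : HasAtMostPoleAt ψ a) :
    HasAtMostPoleAt (deriv ψ) a := by
  obtain ⟨n, g, hg, hψ⟩ := hψ
  have hg' : ContDiffAt ℝ ∞ (_root_.deriv g) a := hg.derivWithin (by simp)
  have hgd : ∀ᶠ x in 𝓝 a, DifferentiableAt ℝ g x :=
    ((hg.of_le (by simp : (1 : ℕ∞ω) ≤ ∞)).eventually (by simp)).mono fun x hx =>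
      hx.differentiableAt (by simp)
  refine ⟨n + 1, fun x => _root_.deriv g x * ((x : ℂ) - a) ^ 1 - n * g x,
    (hg'.mul (contDiffAt_ofReal_sub_pow a 1)).sub (contDiffAt_const.mul hg), ?_⟩
  filter_upwards [eventually_eventually_nhdsWithin.mpr hψ, nhdsWithin_le_nhds hgd,
    eventually_ofReal_sub_ne_zero a, self_mem_nhdsWithin] with x h1 h2 h3 hx
  have h4 : ψ =ᶠ[𝓝 x] fun x => g x / ((x : ℂ) - a) ^ n := by
    rwa [isOpen_compl_singleton.nhdsWithin_eq hx] at h1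
  have h5 : HasDerivAt (fun x : ℝ => ((x : ℂ) - a) ^ n) (n * ((x : ℂ) - a) ^ (n - 1)) x := by
    have h6 : HasDerivAt (fun x : ℝ => (x : ℂ) - a) 1 x :=
      ((hasDerivAt_id x).ofReal_comp.sub_const _).congr_deriv (by simp)
    simpa using h6.fun_pow n
  rw [h4.deriv_eq, (h2.hasDerivAt.fun_div h5 (pow_ne_zero n h3)).deriv]
  rcases n with _ | n
  · simp
    field_simp
  · simp only [Nat.add_sub_cancel]
    push_cast
    field_simp
    ring

lemma HasAtMostPoleAt.neg {ψ : ℝ → ℂ} {a : ℝ} (hψ : HasAtMostPoleAt ψ a) :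
    HasAtMostPoleAt (fun x => -ψ x) a := by
  obtain ⟨n, g, hg, hψ⟩ := hψ
  exact ⟨n, fun x => -g x, hg.neg, by filter_upwards [hψ] with x h1; rw [h1, neg_div]⟩

/-- If `F ψ` is constant on either side of a zero of finite order of `F`, and `ψ` has at most a
pole there, then the two constants agree. -/
lemma HasAtMostPoleAt.eq_of_mul_eq {ψ : ℝ → ℂ} {a : ℝ} (hψ : HasAtMostPoleAt ψ a)
    {F K : ℝ → ℝ} {N : ℕ} (hK : ContDiffAt ℝ ∞ K a)
    (hF : ∀ x, F x = (x - a) ^ N * K x) {cl cr : ℂ} (hl : ∀ᶠ x in 𝓝[<] a, F x * ψ x = cl)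
    (hr : ∀ᶠ x in 𝓝[>] a, F x * ψ x = cr) : cl = cr := by
  obtain ⟨n, g, hg, hψ⟩ := hψ
  have key : ∀ x, x ≠ a → ψ x = g x / ((x : ℂ) - a) ^ n →
      ((x : ℂ) - a) ^ N * K x * g x = (x - a) ^ n • (F x * ψ x) := by
    intro x hx h1
    have h3 : (x : ℂ) - a ≠ 0 := by
      rw [← Complex.ofReal_sub]
      exact Complex.ofReal_ne_zero.mpr (sub_ne_zero.mpr hx)
    rw [h1, hF, Complex.real_smul]
    push_cast
    field_simp
  refine eq_of_eventually_eq_smul (g := fun x => ((x : ℂ) - a) ^ N * K x * g x)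
    (F := fun x => (x - a) ^ n) (K := fun _ => 1) (N := n)
    (((contDiffAt_ofReal_sub_pow a N).mul hK.ofReal_comp).mul hg) contDiffAt_const one_ne_zero
    (by simp) ?_ ?_
  · filter_upwards [hl, hψ.filter_mono (nhdsWithin_mono _ fun x (hx : x < a) => hx.ne),
      self_mem_nhdsWithin] with x h1 h2 hx
    rw [key x (ne_of_lt hx) h2, h1]
  · filter_upwards [hr, hψ.filter_mono (nhdsWithin_mono _ fun x (hx : a < x) => hx.ne'),
      self_mem_nhdsWithin] with x h1 h2 hx
    rw [key x (ne_of_gt hx) h2, h1]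

/-- If `ψ` is a multiple of `F` on either side of a zero of finite order of `F`, and has at most
a pole there, then the two factors agree. -/
lemma HasAtMostPoleAt.eq_of_eq_mul {ψ : ℝ → ℂ} {a : ℝ} (hψ : HasAtMostPoleAt ψ a)
    {F K : ℝ → ℝ} {N : ℕ} (hK : ContDiffAt ℝ ∞ K a) (hKa : K a ≠ 0)
    (hF : ∀ x, F x = (x - a) ^ N * K x) {cl cr : ℂ} (hl : ∀ᶠ x in 𝓝[<] a, ψ x = F x * cl)
    (hr : ∀ᶠ x in 𝓝[>] a, ψ x = F x * cr) : cl = cr := by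
  obtain ⟨n, g, hg, hψ⟩ := hψ
  have key : ∀ x, x ≠ a → ψ x = g x / ((x : ℂ) - a) ^ n → ∀ c : ℂ, ψ x = F x * c →
      g x = ((x - a) ^ n * F x) • c := by
    intro x hx h1 c h2
    have h3 : (x : ℂ) - a ≠ 0 := by
      rw [← Complex.ofReal_sub]
      exact Complex.ofReal_ne_zero.mpr (sub_ne_zero.mpr hx)
    rw [h1, div_eq_iff (pow_ne_zero n h3)] at h2
    rw [h2, Complex.real_smul]
    push_cast
    ring
  refine eq_of_eventually_eq_smul (F := fun x => (x - a) ^ n * F x) (N := n + N) hg hK hKa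
    (Eventually.of_forall fun x => by rw [hF]; ring) ?_ ?_
  · filter_upwards [hl, hψ.filter_mono (nhdsWithin_mono _ fun x (hx : x < a) => hx.ne),
      self_mem_nhdsWithin] with x h1 h2 hx
    exact key x (ne_of_lt hx) h2 _ h1
  · filter_upwards [hr, hψ.filter_mono (nhdsWithin_mono _ fun x (hx : a < x) => hx.ne'),
      self_mem_nhdsWithin] with x h1 h2 hx
    exact key x (ne_of_gt hx) h2 _ h1

/-! ### The Bloch curve of the transform -/

/-- A Bloch function that is, on each interval of the complement of the lattice, a constant multiple
of a function `G` with multiplier `τ` has the multiplier `τ` too, provided that the constants on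
adjacent intervals agree. -/
lemma multiplier_eq_of_eq_mul_const {T : ℝ} (hT : 0 < T) {ψ G : ℝ → ℂ} {κ τ : ℂ} {c : ℤ → ℂ}
    (hc : ∀ j : ℤ, ∀ x ∈ Ioo (j * T) ((j + 1) * T), ψ x = G x * c j)
    (hcc : ∀ j, c j = c (j + 1)) (hψ : ∀ x ∉ poleLattice T, ψ (x + T) = κ * ψ x)
    (hG : ∀ x, G (x + T) = τ * G x) {x : ℝ} (hx : x ∉ poleLattice T) (h0 : ψ x ≠ 0) : κ = τ := by
  obtain ⟨j, hj⟩ := exists_mem_Ioo_of_notMem_poleLattice hT hx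
  have h1 := hψ x hx
  have h2 : x + T ∈ Ioo (((j + 1 : ℤ) : ℝ) * T) (((j + 1 : ℤ) + 1) * T) := by
    push_cast
    constructor <;> nlinarith [hj.1, hj.2]
  rw [hc (j + 1) _ h2, ← hcc, hG, mul_assoc, ← hc j x hj] at h1
  exact (mul_right_cancel₀ h0 h1).symm

namespace IsBlochEigenfunction

variable {T : ℝ} {U : ℝ → ℝ} {m : ℕ} {E₀ ρ : ℝ} {η : ℝ → ℝ}

lemma hasAtMostPoleAt_div (h : IsBlochEigenfunction T U m E₀ ρ η) {w : ℝ → ℝ}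
    (hw : ContDiff ℝ ∞ w) {a : ℝ} (ha : a ∈ poleLattice T) :
    HasAtMostPoleAt (fun x => ((w x / η x : ℝ) : ℂ)) a := by
  obtain ⟨j, rfl⟩ := ha
  obtain ⟨k, hk, hk0, hηk⟩ := h.order_at j
  refine ⟨m + 1, fun x => ((w x / k x : ℝ) : ℂ),
    (hw.contDiffAt.div hk.contDiffAt hk0).ofReal_comp, ?_⟩
  filter_upwards with x
  rw [hηk]
  push_cast
  rw [div_div, mul_comm]

/-- A primitive of a multiple of `η²` that is multiplied by `ρ²` under `x ↦ x + T`. -/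
lemma exists_quasiPeriodic_primitive (h : IsBlochEigenfunction T U m E₀ ρ η) (hT : 0 < T)
    (hη : ∀ x ∈ Ioo 0 T, η x ≠ 0) :
    ∃ (w : ℝ → ℝ) (c : ℝ), ContDiff ℝ ∞ w ∧ (∀ x, HasDerivAt w (c * η x ^ 2) x) ∧
      (∀ x, w (x + T) = ρ ^ 2 * w x) ∧ ∃ x ∉ poleLattice T, w x ≠ 0 := by
  have hmid : T / 2 ∈ Ioo 0 T := ⟨by linarith, by linarith⟩
  have hmid' := Ioo_zero_subset_compl_poleLattice hT hmid
  by_cases hρ : ρ ^ 2 = 1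
  · exact ⟨fun _ => 1, 0, contDiff_const, fun x => by simpa using hasDerivAt_const x (1 : ℝ),
      fun x => by simp [hρ], T / 2, hmid', one_ne_zero⟩
  · have hc : Continuous fun x => η x ^ 2 := h.contDiff.continuous.pow 2
    -- The constant of integration that makes the primitive of `η²` quasi-periodic.
    set a := (∫ t in (0 : ℝ)..T, η t ^ 2) / (ρ ^ 2 - 1) with ha
    have ha' : a * (ρ ^ 2 - 1) = ∫ t in (0 : ℝ)..T, η t ^ 2 :=
      div_mul_cancel₀ _ (sub_ne_zero.mpr hρ)
    have hd : ∀ x, HasDerivAt (fun x => a + ∫ t in (0 : ℝ)..x, η t ^ 2) (1 * η x ^ 2) x :=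
        fun x => by
      rw [one_mul]
      exact (intervalIntegral.integral_hasDerivAt_right (hc.intervalIntegrable _ _)
        hc.aestronglyMeasurable.stronglyMeasurableAtFilter hc.continuousAt).const_add a
    refine ⟨_, 1, ?_, hd, fun x => ?_, ?_⟩
    · rw [contDiff_infty_iff_deriv]
      refine ⟨fun x => (hd x).differentiableAt, ?_⟩
      rw [show deriv _ = _ from funext fun x => (hd x).deriv]
      exact contDiff_const.mul (h.contDiff.pow 2)
    · have h1 : ∫ t in T..x + T, η t ^ 2 = ρ ^ 2 * ∫ t in (0 : ℝ)..x, η t ^ 2 := by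
        have h2 := intervalIntegral.integral_comp_add_right (a := 0) (b := x) (fun t => η t ^ 2) T
        rw [zero_add] at h2
        rw [← h2, ← intervalIntegral.integral_const_mul]
        simp only [h.quasiPeriodic, mul_pow]
      have h3 := intervalIntegral.integral_add_adjacent_intervals
        (hc.intervalIntegrable (μ := MeasureTheory.volume) 0 T) (hc.intervalIntegrable T (x + T))
      rw [← h3, h1]
      linear_combination -ha'
    · by_contra hcon
      push Not at hcon
      have hev : (fun x => a + ∫ t in (0 : ℝ)..x, η t ^ 2) =ᶠ[𝓝 (T / 2)] fun _ => 0 := by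
        filter_upwards [(isOpen_compl_poleLattice T hT).mem_nhds hmid'] with x hx using hcon x hx
      have := (hd (T / 2)).unique ((hasDerivAt_const _ (0 : ℝ)).congr_of_eventuallyEq hev)
      rw [one_mul] at this
      exact hη _ hmid (pow_eq_zero_iff two_ne_zero |>.mp this)

/-- The multiplier of the ground state survives in the Bloch curve of the transform, although the
transformation annihilates the ground state: the solutions `w / η` with `w' = c η²` replace it. -/
lemma mem_blochCurve_darbouxTransform (h : IsBlochEigenfunction T U m E₀ ρ η) (hT : 0 < T)
    (hη : ∀ x ∈ Ioo 0 T, η x ≠ 0) (hU : ContDiffOn ℝ ∞ U (poleLattice T)ᶜ) :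
    ((E₀ : ℂ), (ρ : ℂ)) ∈ blochCurve T (darbouxTransform U η) := by
  have hs := isOpen_compl_poleLattice T hT
  have hVc := (h.contDiffOn_darbouxTransform hT hη hU).continuousOn
  have hD := h.isDarbouxPair hT hη
  obtain ⟨w, c, hw, hwd, hwq, x₀, hx₀, hwx₀⟩ := h.exists_quasiPeriodic_primitive hT hη
  have hlog : ∀ x ∈ (poleLattice T)ᶜ, deriv η x = logDeriv η x * η x := fun x hx => by
    rw [logDeriv_apply, div_mul_cancel₀ _ (h.ne_zero_of_notMem hT hη hx)]
  have hy : ∀ x ∈ (poleLattice T)ᶜ,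
      HasDerivAt (fun x => w x / η x) (c * η x - logDeriv η x * (w x / η x)) x := fun x hx => by
    have hηx := h.ne_zero_of_notMem hT hη hx
    refine ((hwd x).fun_div (h.hasDerivAt x) hηx).congr_deriv ?_
    rw [hlog x hx]
    field_simp
  have hsol : SolvesSchrodingerOn (poleLattice T)ᶜ (darbouxTransform U η) E₀
      fun x => w x / η x := by
    refine .of_hasDerivAt hs hVc hy fun x hx => ?_
    refine (((h.hasDerivAt x).const_mul c).sub
      ((hD.hasDerivAt x hx).fun_mul (hy x hx))).congr_deriv ?_
    rw [hlog x hx, hD.eq_sub x hx, hD.riccati x hx, smul_eq_mul]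
    ring
  refine ⟨fun x => ((w x / η x : ℝ) : ℂ), hsol.ofReal hs hVc,
    fun a ha => h.hasAtMostPoleAt_div hw ha, fun x _ => ?_, x₀, hx₀, ?_⟩
  · simp only
    rw [hwq, h.quasiPeriodic, sq, mul_assoc, mul_div_mul_left _ _ h.ne_zero]
    push_cast
    ring
  · exact Complex.ofReal_ne_zero.mpr (div_ne_zero hwx₀ (h.ne_zero_of_notMem hT hη hx₀))

/-- The Darboux transform of a Bloch solution is a Bloch solution with the same multiplier. It is
stated for `∂ - ε v`, `v = η'/η`, so as to cover the inverse transformation. -/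
lemma bloch_transform (h : IsBlochEigenfunction T U m E₀ ρ η) {ε : ℝ} {ψ : ℝ → ℂ} {κ : ℂ}
    (hpole : ∀ a ∈ poleLattice T, HasAtMostPoleAt ψ a)
    (hκ : ∀ x ∉ poleLattice T, ψ (x + T) = κ * ψ x) (hT : 0 < T)
    (hd : ∀ x ∉ poleLattice T, HasDerivAt ψ (deriv ψ x) x) :
    (∀ a ∈ poleLattice T, HasAtMostPoleAt (fun x => deriv ψ x - (ε * logDeriv η x) • ψ x) a) ∧
    ∀ x ∉ poleLattice T, deriv ψ (x + T) - (ε * logDeriv η (x + T)) • ψ (x + T) =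
      κ * (deriv ψ x - (ε * logDeriv η x) • ψ x) := by
  constructor
  · intro a ha
    have h1 := h.hasAtMostPoleAt_div (contDiff_const (c := ε) |>.mul h.contDiff_deriv) ha
    refine ((hpole a ha).deriv.add (h1.mul (hpole a ha)).neg).of_eventuallyEq
      (Eventually.of_forall fun x => ?_)
    simp only [Complex.real_smul, logDeriv_apply]
    push_cast
    ring
  · intro x hx
    have h1 : deriv ψ (x + T) = κ * deriv ψ x := by
      have h2 : HasDerivAt (fun x => ψ (x + T)) (deriv ψ (x + T)) x :=
        (hd (x + T) (fun hmem => hx (add_mem_poleLattice_iff.mp hmem))).comp_add_const x T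
      have h3 : (fun x => ψ (x + T)) =ᶠ[𝓝 x] fun x => κ * ψ x := by
        filter_upwards [(isOpen_compl_poleLattice T hT).mem_nhds hx] with y hy using hκ y hy
      exact (h2.congr_of_eventuallyEq h3.symm).unique ((hd x hx).const_mul κ)
    rw [h1, hκ x hx, h.logDeriv_periodic x]
    simp only [Complex.real_smul]
    ring

/-- The Crum transform has the same Bloch curve as the original potential. -/
lemma blochCurve_darbouxTransform (h : IsBlochEigenfunction T U m E₀ ρ η) (hT : 0 < T)
    (hη : ∀ x ∈ Ioo 0 T, η x ≠ 0) (hU : ContDiffOn ℝ ∞ U (poleLattice T)ᶜ)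
    (hinv : ((E₀ : ℂ), ((ρ⁻¹ : ℝ) : ℂ)) ∈ blochCurve T U) :
    blochCurve T (darbouxTransform U η) = blochCurve T U := by
  have hs := isOpen_compl_poleLattice T hT
  have hVc := (h.contDiffOn_darbouxTransform hT hη hU).continuousOn
  have hD := h.isDarbouxPair hT hη
  have hlt : ∀ j : ℤ, (j : ℝ) * T < (j + 1) * T := fun j => by nlinarith
  have hηne := fun {x} => h.ne_zero_of_notMem hT hη (x := x)
  have hlog : ∀ x ∈ (poleLattice T)ᶜ, deriv η x = logDeriv η x * η x := fun x hx => by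
    rw [logDeriv_apply, div_mul_cancel₀ _ (hηne hx)]
  apply Subset.antisymm
  · rintro ⟨E, κ⟩ ⟨ψ, hψ, hpole, hκ, x₀, hx₀, hψx₀⟩
    simp only at hψ hκ
    have hd := fun x (hx : x ∉ poleLattice T) => hψ.hasDerivAt hs hx
    obtain ⟨hp1, hp2⟩ := h.bloch_transform (ε := -1) hpole hκ hT hd
    simp only [neg_one_mul] at hp1 hp2
    have hp := hD.symm.solves_transform hs hU.continuousOn hψ
    by_cases hne : ∃ x ∉ poleLattice T, deriv ψ x - (-logDeriv η x) • ψ x ≠ 0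
    · exact ⟨_, hp, hp1, hp2, hne⟩
    push Not at hne
    -- The kernel of `∂ + η'/η` consists of the multiples of `1 / η`.
    have hE : E = E₀ := by
      have h1 := hD.symm.hasDerivAt_transform hs hψ hx₀
      have h2 : (fun x => deriv ψ x - (-logDeriv η x) • ψ x) =ᶠ[𝓝 x₀] fun _ => 0 := by
        filter_upwards [hs.mem_nhds hx₀] with y hy using hne y hy
      have h3 := h1.unique ((hasDerivAt_const x₀ (0 : ℂ)).congr_of_eventuallyEq h2)
      rw [hne x₀ hx₀, smul_zero, sub_zero] at h3
      exact (sub_eq_zero.mp ((mul_eq_zero.mp h3).resolve_right hψx₀)).symm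
    have hconst : ∀ j : ℤ, ∃ c : ℂ, ∀ x ∈ Ioo (j * T) ((j + 1) * T), (η x : ℂ) * ψ x = c := fun j =>
      exists_eq_const_of_hasDerivAt_zero fun x hx => by
        have hx' := Ioo_subset_compl_poleLattice hT j hx
        refine ((h.hasDerivAt x).ofReal_comp.fun_mul (hd x hx')).congr_deriv ?_
        have h1 := hne x hx'
        rw [neg_smul, sub_neg_eq_add, Complex.real_smul] at h1
        rw [hlog x hx']
        push_cast
        linear_combination (η x : ℂ) * h1
    choose c hc using hconst
    have hcc : ∀ j, c j = c (j + 1) := by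
      intro j
      obtain ⟨k, hk, -, hηk⟩ := h.order_at (j + 1)
      refine (hpole (((j + 1 : ℤ) : ℝ) * T) ⟨j + 1, rfl⟩).eq_of_mul_eq hk.contDiffAt hηk ?_ ?_
      · push_cast
        filter_upwards [Ioo_mem_nhdsLT (hlt j)] with x hx using hc j x hx
      · filter_upwards [Ioo_mem_nhdsGT (hlt (j + 1))] with x hx using hc (j + 1) x hx
    have hκ' : κ = ((ρ⁻¹ : ℝ) : ℂ) := by
      refine multiplier_eq_of_eq_mul_const hT (G := fun x => ((η x)⁻¹ : ℝ)) (c := c)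
        (fun j x hx => ?_) hcc hκ
        (fun x => ?_) hx₀ hψx₀
      · have h4 : (η x : ℂ) ≠ 0 :=
          Complex.ofReal_ne_zero.mpr (hηne (Ioo_subset_compl_poleLattice hT j hx))
        rw [← hc j x hx]
        push_cast
        field_simp
      · rw [h.quasiPeriodic, mul_inv]
        push_cast
        ring
    rw [hE, hκ']
    exact hinv
  · rintro ⟨E, κ⟩ ⟨ψ, hψ, hpole, hκ, x₀, hx₀, hψx₀⟩
    simp only at hψ hκ
    have hd := fun x (hx : x ∉ poleLattice T) => hψ.hasDerivAt hs hx
    obtain ⟨hp1, hp2⟩ := h.bloch_transform (ε := 1) hpole hκ hT hd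
    simp only [one_mul] at hp1 hp2
    have hp := hD.solves_transform hs hVc hψ
    by_cases hne : ∃ x ∉ poleLattice T, deriv ψ x - logDeriv η x • ψ x ≠ 0
    · exact ⟨_, hp, hp1, hp2, hne⟩
    push Not at hne
    -- The kernel of `∂ - η'/η` consists of the multiples of `η`.
    have hE : E = E₀ := by
      have h1 := hD.hasDerivAt_transform hs hψ hx₀
      have h2 : (fun x => deriv ψ x - logDeriv η x • ψ x) =ᶠ[𝓝 x₀] fun _ => 0 := by
        filter_upwards [hs.mem_nhds hx₀] with y hy using hne y hy
      have h3 := h1.unique ((hasDerivAt_const x₀ (0 : ℂ)).congr_of_eventuallyEq h2)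
      rw [hne x₀ hx₀, smul_zero, sub_zero] at h3
      exact (sub_eq_zero.mp ((mul_eq_zero.mp h3).resolve_right hψx₀)).symm
    have hconst : ∀ j : ℤ, ∃ c : ℂ, ∀ x ∈ Ioo (j * T) ((j + 1) * T), ψ x / η x = c := fun j =>
      exists_eq_const_of_hasDerivAt_zero fun x hx => by
        have hx' := Ioo_subset_compl_poleLattice hT j hx
        refine ((hd x hx').fun_div (h.hasDerivAt x).ofReal_comp
          (Complex.ofReal_ne_zero.mpr (hηne hx'))).congr_deriv ?_
        have h1 := hne x hx'
        rw [Complex.real_smul, sub_eq_zero] at h1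
        rw [hlog x hx', h1]
        push_cast
        ring
    choose c hc using hconst
    have hc' : ∀ j : ℤ, ∀ x ∈ Ioo (j * T) ((j + 1) * T), ψ x = η x * c j := fun j x hx => by
      rw [← hc j x hx, mul_div_cancel₀ _ (Complex.ofReal_ne_zero.mpr
        (hηne (Ioo_subset_compl_poleLattice hT j hx)))]
    have hcc : ∀ j, c j = c (j + 1) := by
      intro j
      obtain ⟨k, hk, hk0, hηk⟩ := h.order_at (j + 1)
      refine (hpole (((j + 1 : ℤ) : ℝ) * T) ⟨j + 1, rfl⟩).eq_of_eq_mul hk.contDiffAt hk0 hηk ?_ ?_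
      · push_cast
        filter_upwards [Ioo_mem_nhdsLT (hlt j)] with x hx using hc' j x hx
      · filter_upwards [Ioo_mem_nhdsGT (hlt (j + 1))] with x hx using hc' (j + 1) x hx
    have hκ' : κ = (ρ : ℂ) :=
      multiplier_eq_of_eq_mul_const hT (G := fun x => (η x : ℂ)) hc' hcc hκ
        (fun x => by simp [h.quasiPeriodic]) hx₀ hψx₀
    rw [hE, hκ']
    exact h.mem_blochCurve_darbouxTransform hT hη hU

end IsBlochEigenfunction

/-! ### The chain of Crum transformations -/

/-- The induction step: the next Crum transform exists, is unique, and inherits the invariants. -/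
theorem IsCrumState.exists_unique_transform {T : ℝ} (hT : 0 < T) {B : Set (ℂ × ℂ)} {μ : ℕ → ℝ}
    (hμ : StrictMono μ) {m : ℕ} {U : ℝ → ℝ} (h : IsCrumState T B μ m U) :
    ∃ V, IsCrumTransform T U V ∧ (∀ V', IsCrumTransform T U V' → V' = V) ∧
      IsCrumState T B μ (m + 1) V := by
  obtain ⟨η, ρ, hη, hfin, hcard, hB⟩ := h.eigenfunction 0
  simp only [zero_add] at hη hB
  have hpos : ∀ x ∈ Ioo 0 T, η x ≠ 0 := by
    rw [Nat.le_zero, Set.ncard_eq_zero hfin] at hcard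
    exact fun x hx h0 => (hcard ▸ (⟨hx, h0⟩ : x ∈ {x ∈ Ioo 0 T | η x = 0}) : x ∈ (∅ : Set ℝ))
  have hleast : IsLeast (hermitSpectrum T U) (μ m) := by
    rw [h.spectrum]
    refine ⟨⟨0, by simp⟩, ?_⟩
    rintro _ ⟨n, rfl⟩
    exact hμ.monotone (Nat.le_add_left m n)
  have heig : ∀ n, ∃ (f : ℝ → ℝ) (σ : ℝ),
      IsBlochEigenfunction T (darbouxTransform U η) (m + 1) (μ (n + (m + 1))) σ f ∧
      {x ∈ Ioo 0 T | f x = 0}.Finite ∧ {x ∈ Ioo 0 T | f x = 0}.ncard ≤ n ∧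
      ((μ (n + (m + 1)) : ℂ), ((σ⁻¹ : ℝ) : ℂ)) ∈ B := by
    intro n
    obtain ⟨f, σ, hf, hffin, hfcard, hfB⟩ := h.eigenfunction (n + 1)
    rw [show n + 1 + m = n + (m + 1) by ring] at hf hfB
    obtain ⟨g, hg, hgfin, hgcard⟩ := hη.transform hT hpos h.contDiffOn hf
      (hμ.injective.ne (by omega)) hffin hfcard
    exact ⟨g, σ, hg, hgfin, hgcard, hfB⟩
  refine ⟨darbouxTransform U η, ⟨η, hη.isGroundState hT hleast, rfl⟩, ?_, ?_⟩
  · rintro _ ⟨η₁, hη₁, rfl⟩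
    exact hη.darbouxTransform_eq_of_isGroundState hT hpos hleast hη₁
  · refine ⟨hη.darbouxTransform_periodic h.periodic,
      hη.contDiffOn_darbouxTransform hT hpos h.contDiffOn, hη.exists_pole_darbouxTransform h.pole,
      ?_, ?_, heig⟩
    · apply Subset.antisymm
      · intro E hE
        obtain ⟨hE1, hE2⟩ := hη.hermitSpectrum_darbouxTransform_subset hT hpos h.contDiffOn
          h.periodic h.pole hE
        rw [h.spectrum] at hE1
        obtain ⟨n, rfl⟩ := hE1
        rcases n with _ | n
        · exact absurd (by simp) hE2
        · exact ⟨n, by simp only; congr 1; ring⟩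
      · rintro _ ⟨n, rfl⟩
        obtain ⟨f, σ, hf, -⟩ := heig n
        exact hf.mem_hermitSpectrum hT
    · rw [hη.blochCurve_darbouxTransform hT hpos h.contDiffOn (by rw [h.bloch]; exact hB), h.bloch]

theorem exists_unique_isCrumIterate {T : ℝ} (hT : 0 < T) {B : Set (ℂ × ℂ)} {μ : ℕ → ℝ}
    (hμ : StrictMono μ) {U₀ : ℝ → ℝ} (h : IsCrumState T B μ 0 U₀) (r : ℕ) :
    ∃ V, IsCrumIterate T U₀ r V ∧ (∀ V', IsCrumIterate T U₀ r V' → V' = V) ∧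
      IsCrumState T B μ r V := by
  induction r with
  | zero =>
    refine ⟨U₀, .zero, fun V' hV' => ?_, h⟩
    cases hV'
    rfl
  | succ r ih =>
    obtain ⟨U, hU, hUu, hUs⟩ := ih
    obtain ⟨V, hV, hVu, hVs⟩ := hUs.exists_unique_transform hT hμ
    refine ⟨V, .succ hU hV, fun V' hV' => ?_, hVs⟩
    cases hV' with
    | succ h1 h2 =>
      rw [hUu _ h1] at h2
      exact hVu _ h2

theorem mainTheorem11 (T : ℝ) (hT : 0 < T) (U₀ : ℝ → ℝ) (hsmooth : ContDiff ℝ ∞ U₀)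
    (hper : Function.Periodic U₀ T) (R : ℂ[X]) (hfg : IsSpectralCurve T U₀ R) (r : ℕ) :
    (∃! Ur : ℝ → ℝ, IsCrumIterate T U₀ r Ur) ∧
    ∀ Ur : ℝ → ℝ, IsCrumIterate T U₀ r Ur →
      Function.Periodic Ur T ∧
      ContDiffOn ℝ ∞ Ur (poleLattice T)ᶜ ∧
      (∃ h : ℝ → ℝ, ContDiffAt ℝ ∞ h 0 ∧
        ∀ᶠ x in 𝓝[≠] 0, Ur x = (r : ℝ) * ((r : ℝ) + 1) / x ^ 2 + h x) ∧
      blochCurve T Ur = blochCurve T U₀ ∧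
      IsSpectralCurve T Ur R ∧
      ∃ μ : ℕ → ℝ, StrictMono μ ∧ hermitSpectrum T U₀ = Set.range μ ∧
        hermitSpectrum T Ur = Set.range fun n : ℕ => μ (n + r) := by
  obtain ⟨μ, hμ, h0⟩ := exists_isCrumState_zero hT hsmooth hper
  obtain ⟨V, hV, hVu, hVs⟩ := exists_unique_isCrumIterate hT hμ h0 r
  refine ⟨⟨V, hV, hVu⟩, fun Ur hUr => ?_⟩
  obtain rfl := hVu Ur hUr
  refine ⟨hVs.periodic, hVs.contDiffOn, hVs.pole, hVs.bloch, ?_, μ, hμ, ?_, hVs.spectrum⟩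
  · unfold IsSpectralCurve at hfg ⊢
    rwa [hVs.bloch]
  · simpa using h0.spectrum
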